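/- **Setting.** Let $p(x,y)$ be a probability distribution on $\mathcal X\times\{-1,+1\}$ with class priors $\pi_\pm=p(y=\pm1)$, where $\pi_+,\pi_->0$ and $\pi_+\neq\pi_-$, and class-conditional laws $p_\pm=p(x\mid y=\pm1)$. Put $\pi_{\mathrm S}=\pi_+^2+\pi_-^2$, $\pi_{\mathrm D}=2\pi_+\pi_-$, $$p_{\mathrm S}=\tfrac{\pi_+^2}{\pi_{\mathrm S}}\,p_+\otimes p_++\tfrac{\pi_-^2}{\pi_{\mathrm S}}\,p_-\otimes p_-,\qquad p_{\mathrm D}=\tfrac12\,p_+\otimes p_-+\tfrac12\,p_-\otimes p_+,$$ $$\widetilde p_+=\frac{\pi_+p_++\pi_-^2p_-}{\pi_-^2+\pi_+},\qquad \widetilde p_-=\frac{\pi_+^2p_++\pi_-p_-}{\pi_+^2+\pi_-}.$$ **Clean pairs.** Let $\kappa_{\mathrm S}$ and $\kappa_{\mathrm D}$ be laws on $\mathcal X\times\mathcal X$ of a correctly labelled and correctly compared similar, respectively dissimilar, pair $(x^+,x^-)$, listed with the instance judged more likely positive first. It is assumed that for some $w_{\mathrm S},w_{\mathrm D}\in[0,1]$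 and each $t\in\{+,-\}$, the instance $x^t$ has law $w_{\mathrm S}\,\widetilde p_t+(1-w_{\mathrm S})\,p_{\mathrm S}^t$ under $\kappa_{\mathrm S}$ and $w_{\mathrm D}\,\widetilde p_t+(1-w_{\mathrm D})\,p_{\mathrm D}^t$ under $\kappa_{\mathrm D}$, where $p_{\mathrm S}^{\pm},p_{\mathrm D}^{\pm}$ are the first ($+$) and second ($-$) marginals of $p_{\mathrm S},p_{\mathrm D}$. (Weight $1$: the instances follow the comparison laws $\widetilde p_\pm$. Weight $0$: they are distributed as under $p_{\mathrm S}$, $p_{\mathrm D}$.) **Noise.** Let $\rho_{\mathrm S},\rho_{\mathrm D},\rho_{\mathrm C}\in[0,1)$. A similar pair is observed as dissimilar with probability $\rho_{\mathrm S}$, a dissimilar pair as similar with probability $\rho_{\mathrm D}$, and then the two instances are swapped with probability $\rho_{\mathrm C}$, all independently of the instances. So, before swapping, the pairs labelled similar and dissimilar have the laws $$\frac{\pi_{\mathrm S}(1-\rho_{\mathrm S})\kappa_{\mathrm S}+\pi_{\mathrm D}\rho_{\mathrm D}\kappa_{\mathrm D}}{\pi_{\mathrm S}(1-\rho_{\mathrm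 S})+\pi_{\mathrm D}\rho_{\mathrm D}},\qquad \frac{\pi_{\mathrm S}\rho_{\mathrm S}\kappa_{\mathrm S}+\pi_{\mathrm D}(1-\rho_{\mathrm D})\kappa_{\mathrm D}}{\pi_{\mathrm S}\rho_{\mathrm S}+\pi_{\mathrm D}(1-\rho_{\mathrm D})}.$$ Observe independent pairs $(x^+_{\mathrm S,i},x^-_{\mathrm S,i})_{i\le n_{\mathrm S}}$ labelled similar and $(x^+_{\mathrm D,i},x^-_{\mathrm D,i})_{i\le n_{\mathrm D}}$ labelled dissimilar, with these laws after swapping, where $n_{\mathrm S},n_{\mathrm D}\ge1$. **Class and loss.** Let $\mathcal G$ be a class of measurable functions $\mathcal X\to\mathbb R$ (with the usual separability: a countable subset is sequentially dense for pointwise convergence) with $\sup_{g\in\mathcal G}\|g\|_\infty\le C_g$, and let $C_{\mathcal G}$ be a constant such that the Rademacher complexity satisfies $\mathfrak R(\mathcal G;n,\mu)\le C_{\mathcal G}/\sqrt n$ for all $n\ge1$ and all probability measures $\mu$ on $\mathcal X$, where $$\mathfrak R(\mathcal G;n,\mu)=\mathbb E_{x_1,\dots,x_n\sim\mu}\mathbb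 E_\sigma\Big[\sup_{g\in\mathcal G}\frac1n\sum_{i=1}^n\sigma_ig(x_i)\Big]$$ with independent uniform signs $\sigma_i$. Let $\ell:\mathbb R\times\{\pm1\}\to[0,\infty)$ be $L_\ell$-Lipschitz in its first argument with $\ell(z,y)\le C_\ell$ for $|z|\le C_g$. Let $R(g)=\mathbb E_{p(x,y)}[\ell(g(x),y)]$, let $g^*\in\mathcal G$ minimize $R$ over $\mathcal G$, and let $\bar g\in\mathcal G$ be any minimizer over $\mathcal G$ of the empirical risk $$\sum_{t\in\{+,-\}}\ \sum_{U\in\{\mathrm S,\mathrm D\}}\frac1{n_U}\sum_{i=1}^{n_U}\alpha^U_t\begin{pmatrix}\ell(g(x^t_{U,i}),+1)\\ \ell(g(x^t_{U,i}),-1)\end{pmatrix},$$ $$\alpha^{\mathrm S}_t=\frac{\pi_t^2}{\pi_+-\pi_-}(\pi_+,-\pi_-),\qquad \alpha^{\mathrm D}_t=\frac1{\pi_+-\pi_-}\big(\pi_-(\pi_t^2-\pi_{-t}),\ \pi_+(\pi_{-t}-\pi_t^2)\big).$$ **Theorem.** For every $\delta>0$, with probability at least $1-\delta$ (simultaneously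 for all minimizers $\bar g$), $$R(\bar g)-R(g^*)\le C_{\mathcal G,\ell,\delta}\Big(\frac{A_1}{\sqrt{2n_{\mathrm S}}}+\frac{A_2}{\sqrt{2n_{\mathrm D}}}\Big)+C_\ell(B_1+B_2),$$ where, with $K=|\pi_+^2-\pi_-|+|\pi_+-\pi_-^2|$, $$C_{\mathcal G,\ell,\delta}=\frac{4L_\ell C_{\mathcal G}+2C_\ell\sqrt{\log(4/\delta)}}{|\pi_+-\pi_-|},\quad A_1=\frac{\pi_{\mathrm S}(1-\rho_{\mathrm S})+\pi_{\mathrm D}\rho_{\mathrm D}}{(1-\rho_{\mathrm S})(1-\rho_{\mathrm C})},\quad A_2=\frac{K\,(\pi_{\mathrm S}\rho_{\mathrm S}+\pi_{\mathrm D}(1-\rho_{\mathrm D}))}{\pi_{\mathrm D}(1-\rho_{\mathrm D})(1-\rho_{\mathrm C})},$$ $$B_1=\frac{\pi_{\mathrm S}+K}{|\pi_+-\pi_-|}\,\frac{\rho_{\mathrm C}}{1-\rho_{\mathrm C}},\qquad B_2=\frac1{|\pi_+-\pi_-|}\Big\{\frac{\pi_{\mathrm S}\rho_{\mathrm S}}{(1-\rho_{\mathrm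 D})(1-\rho_{\mathrm C})}+\frac{K\rho_{\mathrm D}}{(1-\rho_{\mathrm S})(1-\rho_{\mathrm C})}\Big\}$$ (for $\delta>4$, where the claim is trivial, the square root of the negative logarithm is read as $0$). The bias terms $B_1,B_2$ do not depend on $n_{\mathrm S},n_{\mathrm D}$, and $B_1=B_2=0$ if and only if $\rho_{\mathrm S}=\rho_{\mathrm D}=\rho_{\mathrm C}=0$. -/

import Mathlib

open MeasureTheory ProbabilityTheory Filter Topology
open scoped ENNReal

noncomputable section

namespace SDPcomp

variable {X : Type*} [MeasurableSpace X]

/-! ### Binary classification. The label `+1` is `true`, the label `-1` is `false`. -/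

/-- The class prior `π_t = p(y = t)`. -/
def prior (p : Measure (X × Bool)) (t : Bool) : ℝ := p.real {z | z.2 = t}

/-- The class-conditional law `p_t` of an instance given `y = t`. -/
def classCond (p : Measure (X × Bool)) (t : Bool) : Measure X :=
  (ProbabilityTheory.cond p {z | z.2 = t}).map Prod.fst

/-- The classification risk `R(g) = E_{p(x,y)} [ℓ(g(x), y)]`. -/
def risk (p : Measure (X × Bool)) (ℓ : ℝ → Bool → ℝ) (g : X → ℝ) : ℝ :=
  ∫ z, ℓ (g z.1) z.2 ∂p

/-! ### Similar / dissimilar pairs and pairwise comparisons -/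

/-- `π_S = p(y = y') = π_+² + π_-²`. -/
def priorS (p : Measure (X × Bool)) : ℝ := prior p true ^ 2 + prior p false ^ 2

/-- `π_D = p(y ≠ y') = 2 π_+ π_-`. -/
def priorD (p : Measure (X × Bool)) : ℝ := 2 * prior p true * prior p false

/-- `p_S`, the law of a pair of independent labelled instances given `y = y'`. -/
def pairS (p : Measure (X × Bool)) : Measure (X × X) :=
  ENNReal.ofReal (prior p true ^ 2 / priorS p) • (classCond p true).prod (classCond p true) +
  ENNReal.ofReal (prior p false ^ 2 / priorS p) • (classCond p false).prod (classCond p false)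

/-- `p_D`, the law of a pair of independent labelled instances given `y ≠ y'`. -/
def pairD (p : Measure (X × Bool)) : Measure (X × X) :=
  ENNReal.ofReal (1 / 2) • (classCond p true).prod (classCond p false) +
  ENNReal.ofReal (1 / 2) • (classCond p false).prod (classCond p true)

/-- The comparison laws `p̃_+` (`t = true`, the instance judged more likely positive) and
`p̃_-` (`t = false`, the other instance). -/
def pcompLaw (p : Measure (X × Bool)) : Bool → Measure X
  | true =>
    ENNReal.ofReal (prior p true / (prior p false ^ 2 + prior p true)) • classCond p true +
    ENNReal.ofReal (prior p false ^ 2 / (prior p false ^ 2 + prior p true)) • classCond p false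
  | false =>
    ENNReal.ofReal (prior p true ^ 2 / (prior p true ^ 2 + prior p false)) • classCond p true +
    ENNReal.ofReal (prior p false / (prior p true ^ 2 + prior p false)) • classCond p false

/-- The instance of a pair in position `t`: the first one (`+`) or the second one (`-`). -/
def inst (t : Bool) (z : X × X) : X := if t then z.1 else z.2

/-- `κ` is an admissible law of a pair with correct similarity label and correct comparison,
the pair being listed with the instance that is judged more likely positive first.  The
instance in position `t` follows the comparison law `p̃_t` (`w = 1`), or the law which the
similarity label alone gives it, a marginal of `q`, where `q` is `p_S` or `p_D` (`w = 0`), or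
a mixture of the two with a weight `w` that is the same in both positions. -/
def IsCleanPairLaw (p : Measure (X × Bool)) (q κ : Measure (X × X)) : Prop :=
  ∃ w : ℝ, 0 ≤ w ∧ w ≤ 1 ∧ ∀ t : Bool,
    κ.map (inst t) =
      ENNReal.ofReal w • pcompLaw p t + ENNReal.ofReal (1 - w) • q.map (inst t)

/-! ### Noisy labels -/

/-- The law of a pair given the observed label "similar", when a similar pair (law `κS`) is
observed as dissimilar with probability `ρS` and a dissimilar pair (law `κD`) is observed as
similar with probability `ρD`, independently of the instances. -/
def noisySim (p : Measure (X × Bool)) (ρS ρD : ℝ) (κS κD : Measure (X × X)) :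
    Measure (X × X) :=
  ENNReal.ofReal (priorS p * (1 - ρS) / (priorS p * (1 - ρS) + priorD p * ρD)) • κS +
  ENNReal.ofReal (priorD p * ρD / (priorS p * (1 - ρS) + priorD p * ρD)) • κD

/-- The law of a pair given the observed label "dissimilar". -/
def noisyDis (p : Measure (X × Bool)) (ρS ρD : ℝ) (κS κD : Measure (X × X)) :
    Measure (X × X) :=
  ENNReal.ofReal (priorS p * ρS / (priorS p * ρS + priorD p * (1 - ρD))) • κS +
  ENNReal.ofReal (priorD p * (1 - ρD) / (priorS p * ρS + priorD p * (1 - ρD))) • κD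

/-- Reversal of the comparison with probability `ρC`, independently of everything else. -/
def noisyCompare (ρC : ℝ) (Q : Measure (X × X)) : Measure (X × X) :=
  ENNReal.ofReal (1 - ρC) • Q + ENNReal.ofReal ρC • Q.map Prod.swap

/-- The observed data: `nS` pairs labelled similar and `nD` pairs labelled dissimilar. -/
abbrev Sample (X : Type*) (nS nD : ℕ) : Type _ := (Fin nS → X × X) × (Fin nD → X × X)

/-- The law of the observed noisy data: all pairs are independent, those labelled similar are
identically distributed, and so are those labelled dissimilar. -/
def noisySampleLaw (p : Measure (X × Bool)) (ρS ρD ρC : ℝ) (κS κD : Measure (X × X))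
    (nS nD : ℕ) : Measure (Sample X nS nD) :=
  (Measure.pi fun _ : Fin nS => noisyCompare ρC (noisySim p ρS ρD κS κD)).prod
    (Measure.pi fun _ : Fin nD => noisyCompare ρC (noisyDis p ρS ρD κS κD))

/-! ### The empirical risk and its minimizers -/

/-- The weight `α^S_t`; its entry `y` multiplies `ℓ(·, y)`. -/
def alphaS (p : Measure (X × Bool)) (t y : Bool) : ℝ :=
  prior p t ^ 2 / (prior p true - prior p false) *
    (if y then prior p true else -prior p false)

/-- The weight `α^D_t`; its entry `y` multiplies `ℓ(·, y)`. -/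
def alphaD (p : Measure (X × Bool)) (t y : Bool) : ℝ :=
  1 / (prior p true - prior p false) *
    (if y then prior p false * (prior p t ^ 2 - prior p (!t))
      else prior p true * (prior p (!t) - prior p t ^ 2))

/-- The empirical risk with weights `α` over `n` pairs. -/
def empRiskPart (α : Bool → Bool → ℝ) (ℓ : ℝ → Bool → ℝ) {n : ℕ} (d : Fin n → X × X)
    (g : X → ℝ) : ℝ :=
  ∑ t : Bool, (1 / (n : ℝ)) * ∑ i : Fin n,
    (α t true * ℓ (g (inst t (d i))) true + α t false * ℓ (g (inst t (d i))) false)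

/-- The empirical risk, the sum of the similar part and the dissimilar part. -/
def empRisk (p : Measure (X × Bool)) (ℓ : ℝ → Bool → ℝ) {nS nD : ℕ} (d : Sample X nS nD)
    (g : X → ℝ) : ℝ :=
  empRiskPart (alphaS p) ℓ d.1 g + empRiskPart (alphaD p) ℓ d.2 g

/-! ### The function class -/

/-- The Rademacher complexity
`E_{x_1, …, x_n ∼ μ} E_σ [sup_{g ∈ G} (1/n) ∑ i, σ_i g(x_i)]`. -/
def rademacher (G : Set (X → ℝ)) (n : ℕ) (μ : Measure X) : ℝ :=
  ∫ x : Fin n → X,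
    (1 / (2 : ℝ) ^ n) * ∑ σ : Fin n → ℤˣ,
      ⨆ g : G, (1 / (n : ℝ)) * ∑ i : Fin n, (((σ i : ℤˣ) : ℤ) : ℝ) * (g : X → ℝ) (x i)
    ∂(Measure.pi fun _ : Fin n => μ)

/-- The usual condition under which suprema over `G` are measurable: every member of `G` is
the pointwise limit of a sequence from a fixed countable subset of `G`. -/
def PointwiseSeparable (G : Set (X → ℝ)) : Prop :=
  ∃ G₀ : Set (X → ℝ), G₀ ⊆ G ∧ G₀.Countable ∧
    ∀ g ∈ G, ∃ u : ℕ → X → ℝ, (∀ k, u k ∈ G₀) ∧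
      ∀ x, Tendsto (fun k => u k x) atTop (𝓝 (g x))

/-! ### The constants of the bound -/

/-- `|π_+² - π_-| + |π_+ - π_-²|`. -/
def kD (p : Measure (X × Bool)) : ℝ :=
  |prior p true ^ 2 - prior p false| + |prior p true - prior p false ^ 2|

/-- `C_{G,ℓ,δ}`. -/
def constC (p : Measure (X × Bool)) (L CG Cℓ δ : ℝ) : ℝ :=
  (4 * L * CG + 2 * Cℓ * √(Real.log (4 / δ))) / |prior p true - prior p false|

def constA₁ (p : Measure (X × Bool)) (ρS ρD ρC : ℝ) : ℝ :=
  (priorS p * (1 - ρS) + priorD p * ρD) / ((1 - ρS) * (1 - ρC))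

def constA₂ (p : Measure (X × Bool)) (ρS ρD ρC : ℝ) : ℝ :=
  (kD p * (priorS p * ρS + priorD p * (1 - ρD))) / (priorD p * (1 - ρD) * (1 - ρC))

def constB₁ (p : Measure (X × Bool)) (ρC : ℝ) : ℝ :=
  (priorS p + kD p) / |prior p true - prior p false| * (ρC / (1 - ρC))

def constB₂ (p : Measure (X × Bool)) (ρS ρD ρC : ℝ) : ℝ :=
  1 / |prior p true - prior p false| *
    (priorS p * ρS / ((1 - ρD) * (1 - ρC)) + kD p * ρD / ((1 - ρS) * (1 - ρC)))

end SDPcomp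

end

set_option linter.unusedSectionVars false

namespace SDPcomp

/-! ### The bounded differences inequality -/

/-! The empirical risk averages `lossS` with position weights `weightS` over similar pairs, and
`lossD` with weights `weightD` over dissimilar ones. Let u_t and v_t be the means of `lossS ∘ g` and
`lossD ∘ g` under p_t. Two facts justify the weights. The risk is (π_+² u_+ + π_-² u_- + π_+π_-(v_+
+ v_-)) / (π_+ - π_-) (`risk_eq_lossS_lossD`). The weighted sum over the two positions of a clean
similar pair gives the u-part and that of a clean dissimilar pair gives the v-part, for every mixing
weight w, because w is the same in both positions (`sum_sq_mul_meanC`, `sum_weight_mul_meanC`).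
Without noise the empirical risk is therefore unbiased.

Bias. The comparison laws give the correct value whatever the similarity label, so a mislabelled
pair causes an error only through its 1 - w part; this error is a multiple of u_+ - u_- or v_+ - v_-
(`risk_decomposition`). Swapping multiplies the rest by 1 - ρC and adds ρC times the same sums with
the two weights exchanged. After division by 1 - ρC, and on differences between two functions of the
class, these errors are at most C_ℓ(B₁ + B₂) (`excess_risk_sub_noisyRisk_le`).

Estimation. An empirical minimizer has excess expected noisy risk at most its deviation minus the
deviation of g*, hence at most the supremum over the class of such differences. McDiarmid's
inequality concentrates this supremum; symmetrization and the Ledoux–Talagrand contraction bound its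
mean by the Rademacher complexities of the two instance marginals (`exists_uniform_deviation`). The
similar and the dissimilar sample each receive failure probability δ/2. The stated constants leave
room to spare. -/

theorem integrable_of_abs_le {Ω : Type*} [MeasurableSpace Ω] {μ : Measure Ω} [IsFiniteMeasure μ]
    {f : Ω → ℝ} (hf : Measurable f) {B : ℝ} (hB : ∀ x, |f x| ≤ B) : Integrable f μ :=
  Integrable.of_bound hf.aestronglyMeasurable B (ae_of_all _ hB)

theorem abs_integral_le_of_abs_le {Ω : Type*} [MeasurableSpace Ω] {μ : Measure Ω}
    [IsProbabilityMeasure μ] {f : Ω → ℝ} {B : ℝ} (hB : ∀ x, |f x| ≤ B) : |∫ x, f x ∂μ| ≤ B := by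
  have := norm_integral_le_of_norm_le_const (μ := μ) (f := f) (C := B) (ae_of_all _ hB)
  simpa using this

theorem integrable_exp_of_abs_le {Ω : Type*} [MeasurableSpace Ω] {μ : Measure Ω}
    [IsFiniteMeasure μ] {f : Ω → ℝ} (hf : Measurable f) {B : ℝ} (hB : ∀ x, |f x| ≤ B) (s : ℝ) :
    Integrable (fun x => Real.exp (s * f x)) μ := by
  refine integrable_of_abs_le (B := Real.exp (|s| * B)) (by fun_prop) fun x => ?_
  rw [abs_of_pos (Real.exp_pos _)]
  refine Real.exp_le_exp.2 ((le_abs_self _).trans ?_)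
  rw [abs_mul]
  exact mul_le_mul_of_nonneg_left (hB x) (abs_nonneg s)

/-- Hoeffding's lemma for a function of oscillation at most `c`. -/
theorem integral_exp_centered_le {Y : Type*} [MeasurableSpace Y] (μ : Measure Y)
    [IsProbabilityMeasure μ] {F : Y → ℝ} (hF : Measurable F) {B c : ℝ} (hB : ∀ x, |F x| ≤ B)
    (hc : ∀ x y, |F x - F y| ≤ c) (s : ℝ) :
    ∫ x, Real.exp (s * (F x - ∫ y, F y ∂μ)) ∂μ ≤ Real.exp ((c / 2) ^ 2 * s ^ 2 / 2) := by
  have : Nonempty Y := nonempty_of_isProbabilityMeasure μ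
  have hbdd : BddBelow (Set.range F) := ⟨-B, by rintro _ ⟨x, rfl⟩; exact (abs_le.1 (hB x)).1⟩
  have hmem : ∀ᵐ x ∂μ, F x ∈ Set.Icc (⨅ y, F y) ((⨅ y, F y) + c) := by
    refine ae_of_all _ fun x => ⟨ciInf_le hbdd x, ?_⟩
    have : F x - c ≤ ⨅ y, F y := le_ciInf fun y => by
      have := (abs_le.1 (hc x y)).2
      linarith
    linarith
  have h := (hasSubgaussianMGF_of_mem_Icc hF.aemeasurable hmem).mgf_le s
  have hc0 : 0 ≤ c := (abs_nonneg _).trans (hc (Classical.arbitrary Y) (Classical.arbitrary Y))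
  simpa [mgf, abs_of_nonneg hc0] using h

theorem integral_pi_succ {Y : Type*} [MeasurableSpace Y] (μ : Measure Y) [SigmaFinite μ] {n : ℕ}
    (f : (Fin (n + 1) → Y) → ℝ) :
    ∫ x, f x ∂(Measure.pi fun _ : Fin (n + 1) => μ) =
      ∫ z : Y × (Fin n → Y), f (Fin.cons z.1 z.2) ∂(μ.prod (Measure.pi fun _ : Fin n => μ)) := by
  have h := (measurePreserving_piFinSuccAbove (fun _ : Fin (n + 1) => μ) 0).symm
  rw [← h.integral_comp']
  simp [MeasurableEquiv.piFinSuccAbove, Fin.insertNthEquiv]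

/-- The martingale argument, written as induction on the number of coordinates: the deviation from
the mean is that of the first coordinate's conditional mean plus that of the section, and each
coordinate contributes one Hoeffding factor. -/
theorem integral_exp_centered_pi_le {Y : Type*} [MeasurableSpace Y] (μ : Measure Y)
    [IsProbabilityMeasure μ] {B c : ℝ} (s : ℝ) (n : ℕ) (f : (Fin n → Y) → ℝ) (hf : Measurable f)
    (hB : ∀ x, |f x| ≤ B) (hc : ∀ x i y, |f x - f (Function.update x i y)| ≤ c) :
    ∫ x, Real.exp (s * (f x - ∫ y, f y ∂(Measure.pi fun _ : Fin n => μ)))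
        ∂(Measure.pi fun _ : Fin n => μ) ≤
      Real.exp (n * (c / 2) ^ 2 * s ^ 2 / 2) := by
  induction n with
  | zero =>
    have : ∀ x : Fin 0 → Y, x = default := fun x => Subsingleton.elim _ _
    simp only [this]
    simp
  | succ n ih =>
    set P := Measure.pi fun _ : Fin n => μ with hP
    have hcons : Measurable fun z : Y × (Fin n → Y) => (Fin.cons z.1 z.2 : Fin (n + 1) → Y) := by
      refine measurable_pi_iff.2 fun i => ?_
      refine Fin.cases ?_ (fun j => ?_) i
      · simpa using measurable_fst
      · simpa [Function.comp_def] using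
          (measurable_pi_apply (X := fun _ : Fin n => Y) j).comp measurable_snd
    have hh : Measurable fun z : Y × (Fin n → Y) => f (Fin.cons z.1 z.2) := hf.comp hcons
    have hsec : ∀ a : Y, Measurable fun x : Fin n → Y => f (Fin.cons a x) := fun a =>
      hh.comp measurable_prodMk_left
    -- The conditional mean given the first coordinate; it inherits both the bound `B` and the
    -- oscillation `c`.
    set F : Y → ℝ := fun a => ∫ x, f (Fin.cons a x) ∂P with hFdef
    have hFm : Measurable F := (hh.stronglyMeasurable.integral_prod_right (ν := P)).measurable
    have hFB : ∀ a, |F a| ≤ B := fun a => abs_integral_le_of_abs_le fun x => hB _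
    have hFc : ∀ a b, |F a - F b| ≤ c := by
      intro a b
      rw [hFdef]
      simp only
      rw [← integral_sub (integrable_of_abs_le (hsec a) fun _ => hB _)
        (integrable_of_abs_le (hsec b) fun _ => hB _)]
      refine abs_integral_le_of_abs_le fun x => ?_
      have := hc (Fin.cons a x) 0 b
      rwa [Fin.update_cons_zero] at this
    rw [integral_pi_succ, integral_pi_succ]
    rw [integral_prod (fun z : Y × (Fin n → Y) => f (Fin.cons z.1 z.2))
      (integrable_of_abs_le hh fun _ => hB _)]
    change ∫ z : Y × (Fin n → Y), Real.exp (s * (f (Fin.cons z.1 z.2) - ∫ a, F a ∂μ)) ∂_ ≤ _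
    set m := ∫ a, F a ∂μ with hm
    have hmB : |m| ≤ B := abs_integral_le_of_abs_le hFB
    have hbd : ∀ u v : ℝ, |u| ≤ B → |v| ≤ B → |u - v| ≤ 2 * B := fun u v hu hv => by
      rw [abs_le] at *
      constructor <;> linarith
    rw [integral_prod _ (integrable_exp_of_abs_le (B := 2 * B) (hh.sub_const m)
      (fun z => hbd _ _ (hB _) hmB) s)]
    have key : ∀ a, ∫ x, Real.exp (s * (f (Fin.cons a x) - m)) ∂P ≤
        Real.exp (s * (F a - m)) * Real.exp (n * (c / 2) ^ 2 * s ^ 2 / 2) := by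
      intro a
      have h1 := ih (fun x => f (Fin.cons a x)) (hsec a) (fun _ => hB _) fun x i y => by
        have := hc (Fin.cons a x) i.succ y
        rwa [← Fin.cons_update] at this
      have h2 : ∀ x, Real.exp (s * (f (Fin.cons a x) - m)) =
          Real.exp (s * (F a - m)) * Real.exp (s * (f (Fin.cons a x) - F a)) := fun x => by
        rw [← Real.exp_add]
        ring_nf
      simp_rw [h2]
      rw [integral_const_mul]
      exact mul_le_mul_of_nonneg_left h1 (Real.exp_pos _).le
    have hiF := integrable_exp_of_abs_le (μ := μ) (B := 2 * B) (hFm.sub_const m)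
      (fun z => hbd _ _ (hFB _) hmB) s
    calc ∫ a, ∫ x, Real.exp (s * (f (Fin.cons a x) - m)) ∂P ∂μ
        ≤ ∫ a, Real.exp (s * (F a - m)) * Real.exp (n * (c / 2) ^ 2 * s ^ 2 / 2) ∂μ :=
          integral_mono_of_nonneg
            (ae_of_all _ fun a => integral_nonneg fun x => (Real.exp_pos _).le)
            (hiF.mul_const _) (ae_of_all _ key)
      _ ≤ Real.exp ((c / 2) ^ 2 * s ^ 2 / 2) * Real.exp (n * (c / 2) ^ 2 * s ^ 2 / 2) := by
          rw [integral_mul_const]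
          exact mul_le_mul_of_nonneg_right (integral_exp_centered_le μ hFm hFB hFc s)
            (Real.exp_pos _).le
      _ = _ := by
          rw [← Real.exp_add]
          push_cast
          ring_nf

/-- **McDiarmid's inequality** for identically distributed coordinates. -/
theorem hasSubgaussianMGF_pi_of_bounded_differences {Y : Type*} [MeasurableSpace Y] (μ : Measure Y)
    [IsProbabilityMeasure μ] {B c : ℝ} {n : ℕ} {f : (Fin n → Y) → ℝ} (hf : Measurable f)
    (hB : ∀ x, |f x| ≤ B) (hc : ∀ x i y, |f x - f (Function.update x i y)| ≤ c) :
    HasSubgaussianMGF (fun x => f x - ∫ y, f y ∂(Measure.pi fun _ : Fin n => μ))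
      (NNReal.mk (n * (c / 2) ^ 2) (by positivity)) (Measure.pi fun _ : Fin n => μ) := by
  have hmB : |∫ y, f y ∂(Measure.pi fun _ : Fin n => μ)| ≤ B := abs_integral_le_of_abs_le hB
  refine ⟨fun s => integrable_exp_of_abs_le (B := 2 * B) (hf.sub_const _) (fun x => ?_) s,
    fun s => integral_exp_centered_pi_le μ s n f hf hB hc⟩
  have := hB x
  rw [abs_le] at *
  constructor <;> linarith

/-- McDiarmid's inequality at confidence level `1 - δ`. -/
theorem measureReal_pi_deviation_le {Y : Type*} [MeasurableSpace Y] (μ : Measure Y)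
    [IsProbabilityMeasure μ] {B c δ : ℝ} {n : ℕ} (hn : 0 < n) {f : (Fin n → Y) → ℝ}
    (hf : Measurable f) (hB : ∀ x, |f x| ≤ B) (hc0 : 0 ≤ c)
    (hc : ∀ x i y, |f x - f (Function.update x i y)| ≤ c) (hδ : 0 < δ) (hδ1 : δ ≤ 1) :
    (Measure.pi fun _ : Fin n => μ).real
        {x | c * √(n * Real.log (1 / δ) / 2) <
          f x - ∫ y, f y ∂(Measure.pi fun _ : Fin n => μ)} ≤ δ := by
  have hsg := hasSubgaussianMGF_pi_of_bounded_differences μ hf hB hc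
  have hlog : 0 ≤ Real.log (1 / δ) := Real.log_nonneg (by rw [le_div_iff₀ hδ]; linarith)
  have hn' : (0 : ℝ) < n := by exact_mod_cast hn
  -- The degenerate case needs its own argument: for `c = 0` the Chernoff exponent would be 0/0,
  -- read as 0, and give only the bound 1. Variance proxy 0 forces the deviation to vanish almost
  -- surely.
  rcases hc0.eq_or_lt with rfl | hc0
  · have h0 : NNReal.mk (n * ((0 : ℝ) / 2) ^ 2) (by positivity) = 0 := by
      ext
      simp
    rw [h0] at hsg
    have hae := hsg.ae_eq_zero_of_hasSubgaussianMGF_zero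
    have : (Measure.pi fun _ : Fin n => μ) {x | 0 * √(n * Real.log (1 / δ) / 2) <
        f x - ∫ y, f y ∂(Measure.pi fun _ : Fin n => μ)} = 0 := by
      refine measure_mono_null (fun x hx => ?_) (ae_iff.1 hae)
      simp only [zero_mul, Set.mem_ofPred_eq] at hx
      exact hx.ne'
    rw [measureReal_def, this]
    simpa using hδ.le
  · have hle := hsg.measure_ge_le (ε := c * √(n * Real.log (1 / δ) / 2)) (by positivity)
    refine (measureReal_mono ?_ (measure_ne_top _ _)).trans (hle.trans ?_)
    · intro x hx
      simp only [Set.mem_ofPred_eq] at hx ⊢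
      exact hx.le
    rw [mul_pow, Real.sq_sqrt (by positivity)]
    have : -(c ^ 2 * (n * Real.log (1 / δ) / 2)) /
        (2 * (NNReal.mk (n * (c / 2) ^ 2) (by positivity) : ℝ)) = Real.log δ := by
      rw [NNReal.coe_mk, one_div, Real.log_inv]
      field_simp
    rw [this, Real.exp_log hδ]

/-! ### Suprema of bounded families -/

section Sup

variable {Γ : Type*}

theorem bddAbove_of_abs_le {h : Γ → ℝ} {B : ℝ} (hB : ∀ g, |h g| ≤ B) :
    BddAbove (Set.range h) :=
  ⟨B, by rintro _ ⟨g, rfl⟩; exact (abs_le.1 (hB g)).2⟩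

theorem abs_iSup_le_of_abs_le [Nonempty Γ] {h : Γ → ℝ} {B : ℝ} (hB : ∀ g, |h g| ≤ B) :
    |⨆ g, h g| ≤ B :=
  abs_le.2 ⟨(abs_le.1 (hB (Classical.arbitrary Γ))).1.trans
    (le_ciSup (bddAbove_of_abs_le hB) _), ciSup_le fun g => (abs_le.1 (hB g)).2⟩

theorem abs_sum_le_card_mul {ι : Type*} [Fintype ι] {a : ι → ℝ} {B : ℝ} (h : ∀ i, |a i| ≤ B) :
    |∑ i, a i| ≤ Fintype.card ι * B := by
  refine (Finset.abs_sum_le_sum_abs _ _).trans ?_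
  simpa using Finset.sum_le_card_nsmul Finset.univ _ B fun i _ => h i

theorem abs_unit_mul (u : ℤˣ) (a : ℝ) : |((u : ℤ) : ℝ) * a| = |a| := by
  rcases Int.units_eq_one_or u with rfl | rfl <;> simp

/-- One step of the contraction principle. For near-maximizers g, g' on the left, p g - p g' is at
most |q g - q g'|, and that value is attained on the right by g, g' in one of the two orders. -/
theorem iSup_add_iSup_le_of_abs_sub_le [Nonempty Γ] {h p q : Γ → ℝ}
    (h₁ : BddAbove (Set.range fun g => h g + q g)) (h₂ : BddAbove (Set.range fun g => h g - q g))
    (hpq : ∀ g g', |p g - p g'| ≤ |q g - q g'|) :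
    (⨆ g, (h g + p g)) + (⨆ g, (h g - p g)) ≤ (⨆ g, (h g + q g)) + ⨆ g, (h g - q g) := by
  rw [← le_sub_iff_add_le]
  refine ciSup_le fun g => ?_
  rw [le_sub_comm]
  refine ciSup_le fun g' => ?_
  have h0 := (le_abs_self _).trans (hpq g g')
  rcases le_total (q g') (q g) with hq | hq
  · rw [abs_of_nonneg (sub_nonneg.2 hq)] at h0
    have := le_ciSup h₁ g
    have := le_ciSup h₂ g'
    linarith
  · rw [abs_of_nonpos (sub_nonpos.2 hq)] at h0
    have := le_ciSup h₁ g'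
    have := le_ciSup h₂ g
    linarith

/-! ### The contraction principle -/

variable {ι : Type*} [Fintype ι] [DecidableEq ι]

/-- Flipping one sign is an involution, so an inequality between sums over sign vectors may be
checked on the pairs it exchanges. -/
theorem sum_signs_le_of_flip_le (i : ι) {F F' : (ι → ℤˣ) → ℝ}
    (h : ∀ σ, F σ + F (Function.update σ i (-σ i)) ≤ F' σ + F' (Function.update σ i (-σ i))) :
    ∑ σ, F σ ≤ ∑ σ, F' σ := by
  have hinv : Function.Involutive fun σ : ι → ℤˣ => Function.update σ i (-σ i) := fun σ => by
    simp
  have e : ∀ H : (ι → ℤˣ) → ℝ, ∑ σ, H (Function.update σ i (-σ i)) = ∑ σ, H σ := fun H =>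
    Equiv.sum_comp hinv.toPerm H
  have := Finset.sum_le_sum fun σ (_ : σ ∈ Finset.univ) => h σ
  rw [Finset.sum_add_distrib, Finset.sum_add_distrib, e F, e F'] at this
  linarith

theorem sum_update_neg_mul (i : ι) (σ : ι → ℤˣ) (a : ι → ℝ) :
    ∑ j, ((Function.update σ i (-σ i) j : ℤ) : ℝ) * a j =
      ∑ j ∈ Finset.univ.erase i, ((σ j : ℤ) : ℝ) * a j - ((σ i : ℤ) : ℝ) * a i := by
  rw [← Finset.sum_erase_add _ _ (Finset.mem_univ i)]
  simp only [Function.update_self, Units.val_neg, Int.cast_neg, neg_mul, ← sub_eq_add_neg]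
  congr 1
  refine Finset.sum_congr rfl fun j hj => ?_
  rw [Function.update_of_ne (Finset.ne_of_mem_erase hj)]

theorem sum_iSup_signs_le_of_eq_off [Nonempty Γ] (i : ι) {v u : ι → Γ → ℝ} {B : ℝ}
    (hu : ∀ i g, |u i g| ≤ B) (hne : ∀ j, j ≠ i → v j = u j)
    (h : ∀ g g', |v i g - v i g'| ≤ |u i g - u i g'|) :
    ∑ σ : ι → ℤˣ, ⨆ g, ∑ j, ((σ j : ℤ) : ℝ) * v j g ≤
      ∑ σ : ι → ℤˣ, ⨆ g, ∑ j, ((σ j : ℤ) : ℝ) * u j g := by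
  have hbd : ∀ σ : ι → ℤˣ, BddAbove (Set.range fun g => ∑ j, ((σ j : ℤ) : ℝ) * u j g) :=
    fun σ => bddAbove_of_abs_le fun g => abs_sum_le_card_mul fun j => by
      rw [abs_unit_mul]
      exact hu j g
  refine sum_signs_le_of_flip_le i fun σ => ?_
  have h₁ := hbd σ
  have h₂ := hbd (Function.update σ i (-σ i))
  have e1 : ∀ g, ∑ j ∈ Finset.univ.erase i, ((σ j : ℤ) : ℝ) * v j g =
      ∑ j ∈ Finset.univ.erase i, ((σ j : ℤ) : ℝ) * u j g := fun g =>
    Finset.sum_congr rfl fun j hj => by rw [hne j (Finset.ne_of_mem_erase hj)]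
  simp only [sum_update_neg_mul i σ (fun j => u j _), sum_update_neg_mul i σ (fun j => v j _)] at h₂ ⊢
  simp only [← Finset.sum_erase_add _ _ (Finset.mem_univ i), e1] at h₁ ⊢
  refine iSup_add_iSup_le_of_abs_sub_le h₁ h₂ fun g g' => ?_
  rw [← mul_sub, ← mul_sub, abs_unit_mul, abs_unit_mul]
  exact h g g'

/-- The **contraction principle** of Ledoux and Talagrand for Rademacher sums. -/
theorem sum_iSup_signs_le_of_contraction [Nonempty Γ] {v u : ι → Γ → ℝ} {B : ℝ}
    (hv : ∀ i g, |v i g| ≤ B) (hu : ∀ i g, |u i g| ≤ B)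
    (h : ∀ i g g', |v i g - v i g'| ≤ |u i g - u i g'|) :
    ∑ σ : ι → ℤˣ, ⨆ g, ∑ j, ((σ j : ℤ) : ℝ) * v j g ≤
      ∑ σ : ι → ℤˣ, ⨆ g, ∑ j, ((σ j : ℤ) : ℝ) * u j g := by
  -- Hybrid argument: `u` is replaced by `v` one coordinate at a time.
  have key : ∀ T : Finset ι,
      ∑ σ : ι → ℤˣ, ⨆ g, ∑ j, ((σ j : ℤ) : ℝ) * (if j ∈ T then v j else u j) g ≤
        ∑ σ : ι → ℤˣ, ⨆ g, ∑ j, ((σ j : ℤ) : ℝ) * u j g := by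
    intro T
    induction T using Finset.induction_on with
    | empty => simp
    | insert i T hi ih =>
      refine le_trans ?_ ih
      refine sum_iSup_signs_le_of_eq_off i (B := B) (fun j g => ?_) (fun j hj => ?_) fun g g' => ?_
      · split_ifs
        exacts [hv j g, hu j g]
      · simp [hj]
      · simpa [hi] using h i g g'
  simpa using key Finset.univ

end Sup

/-! ### Symmetrization -/

theorem MeasurePreserving.integral_comp_measurable {α β : Type*} [MeasurableSpace α]
    [MeasurableSpace β] {μ : Measure α} {ν : Measure β} {T : α → β} (hT : MeasurePreserving T μ ν)
    {F : β → ℝ} (hF : Measurable F) : ∫ x, F (T x) ∂μ = ∫ y, F y ∂ν := by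
  rw [← hT.map_eq, integral_map hT.measurable.aemeasurable hF.aestronglyMeasurable]

theorem measurePreserving_eval {Y : Type*} [MeasurableSpace Y] (μ : Measure Y)
    [IsProbabilityMeasure μ] {n : ℕ} (i : Fin n) :
    MeasurePreserving (fun x : Fin n → Y => x i) (Measure.pi fun _ : Fin n => μ) μ :=
  MeasureTheory.measurePreserving_eval (fun _ : Fin n => μ) i

section Symm

variable {Y Γ : Type*} [MeasurableSpace Y] [Countable Γ] [Nonempty Γ] (μ : Measure Y)
  [IsProbabilityMeasure μ] {f : Γ → Y → ℝ} {B : ℝ} (n : ℕ)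

/-- The ghost sample: the mean is an expectation over an independent copy, and by Jensen the
supremum of an expectation is at most the expectation of the supremum. -/
theorem integral_iSup_deviation_le (hf : ∀ g, Measurable (f g)) (hB : ∀ g y, |f g y| ≤ B) :
    ∫ x, ⨆ g, ∑ i, (∫ y, f g y ∂μ - f g (x i)) ∂(Measure.pi fun _ : Fin n => μ) ≤
      ∫ z : Fin n → Y × Y, ⨆ g, ∑ i, (f g (z i).1 - f g (z i).2)
        ∂(Measure.pi fun _ : Fin n => μ.prod μ) := by
  set P := Measure.pi fun _ : Fin n => μ with hP
  have hbd : ∀ u v : ℝ, |u| ≤ B → |v| ≤ B → |u - v| ≤ 2 * B := fun u v hu hv => by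
    rw [abs_le] at *
    constructor <;> linarith
  have hfx : ∀ g (i : Fin n), Measurable fun x : Fin n → Y => f g (x i) := fun g i =>
    (hf g).comp (measurable_pi_apply i)
  have hHm : Measurable fun w : (Fin n → Y) × (Fin n → Y) =>
      ⨆ g, ∑ i, (f g (w.1 i) - f g (w.2 i)) :=
    Measurable.iSup fun g => Finset.measurable_sum _ fun i _ =>
      ((hfx g i).comp measurable_fst).sub ((hfx g i).comp measurable_snd)
  have hsb : ∀ (x' x : Fin n → Y) g,
      |∑ i, (f g (x' i) - f g (x i))| ≤ Fintype.card (Fin n) * (2 * B) :=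
    fun x' x g => abs_sum_le_card_mul fun i => hbd _ _ (hB _ _) (hB _ _)
  have hHB : ∀ w : (Fin n → Y) × (Fin n → Y),
      |⨆ g, ∑ i, (f g (w.1 i) - f g (w.2 i))| ≤ Fintype.card (Fin n) * (2 * B) :=
    fun w => abs_iSup_le_of_abs_le (hsb _ _)
  have hmp := measurePreserving_arrowProdEquivProdArrow Y Y (Fin n) (fun _ => μ) (fun _ => μ)
  have e : ∫ z : Fin n → Y × Y, ⨆ g, ∑ i, (f g (z i).1 - f g (z i).2)
      ∂(Measure.pi fun _ : Fin n => μ.prod μ) =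
      ∫ w : (Fin n → Y) × (Fin n → Y), ⨆ g, ∑ i, (f g (w.1 i) - f g (w.2 i)) ∂(P.prod P) :=
    MeasurePreserving.integral_comp_measurable hmp hHm
  rw [e, integral_prod_symm _ (integrable_of_abs_le hHm hHB)]
  have hmB : ∀ g, |∫ y, f g y ∂μ| ≤ B := fun g => abs_integral_le_of_abs_le (hB g)
  refine integral_mono (integrable_of_abs_le (B := Fintype.card (Fin n) * (2 * B))
    (Measurable.iSup fun g => Finset.measurable_sum _ fun i _ => (hfx g i).const_sub _)
    fun x => abs_iSup_le_of_abs_le fun g => abs_sum_le_card_mul fun i =>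
      hbd _ _ (hmB g) (hB _ _))
    (integrable_of_abs_le (hHm.stronglyMeasurable.integral_prod_left (μ := P)).measurable
      fun x => abs_integral_le_of_abs_le fun x' => hHB (x', x)) fun x => ?_
  refine ciSup_le fun g => ?_
  have e2 : ∑ i, (∫ y, f g y ∂μ - f g (x i)) = ∫ x', ∑ i, (f g (x' i) - f g (x i)) ∂P := by
    rw [integral_finsetSum]
    · refine Finset.sum_congr rfl fun i _ => ?_
      rw [integral_sub (integrable_of_abs_le (hfx g i) fun x => hB _ _) (integrable_const _),
        MeasurePreserving.integral_comp_measurable (measurePreserving_eval μ i) (hf g)]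
      simp
    · exact fun i _ => integrable_of_abs_le ((hfx g i).sub_const _) fun x => hbd _ _ (hB _ _) (hB _ _)
  rw [e2]
  exact integral_mono (integrable_of_abs_le (Finset.measurable_sum _ fun i _ =>
      (hfx g i).sub_const _) fun x' => hsb x' x g)
    (integrable_of_abs_le (hHm.comp measurable_prodMk_right) fun x' => hHB (x', x))
    fun x' => le_ciSup (bddAbove_of_abs_le (hsb x' x)) g

/-- Exchanging a point with its ghost wherever the sign is -1 preserves the law and inserts σ into
the difference. The supremum is then split, the ghost half carrying the signs -σ. -/
theorem integral_iSup_signed_difference_le (hf : ∀ g, Measurable (f g)) (hB : ∀ g y, |f g y| ≤ B)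
    (σ : Fin n → ℤˣ) :
    ∫ z : Fin n → Y × Y, ⨆ g, ∑ i, (f g (z i).1 - f g (z i).2)
        ∂(Measure.pi fun _ : Fin n => μ.prod μ) ≤
      ∫ x, ⨆ g, ∑ i, ((σ i : ℤ) : ℝ) * f g (x i) ∂(Measure.pi fun _ : Fin n => μ) +
      ∫ x, ⨆ g, ∑ i, (((-σ) i : ℤ) : ℝ) * f g (x i) ∂(Measure.pi fun _ : Fin n => μ) := by
  have hfx : ∀ g (i : Fin n), Measurable fun x : Fin n → Y => f g (x i) := fun g i =>
    (hf g).comp (measurable_pi_apply i)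
  have hf1 : ∀ g (i : Fin n), Measurable fun z : Fin n → Y × Y => f g (z i).1 := fun g i =>
    (hf g).comp (measurable_fst.comp (measurable_pi_apply i))
  have hf2 : ∀ g (i : Fin n), Measurable fun z : Fin n → Y × Y => f g (z i).2 := fun g i =>
    (hf g).comp (measurable_snd.comp (measurable_pi_apply i))
  have hm : ∀ τ : Fin n → ℤˣ, Measurable fun x : Fin n → Y =>
      ⨆ g, ∑ i, ((τ i : ℤ) : ℝ) * f g (x i) := fun τ =>
    Measurable.iSup fun g => Finset.measurable_sum _ fun i _ => (hfx g i).const_mul _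
  have hb : ∀ (τ : Fin n → ℤˣ) (x : Fin n → Y) g,
      |∑ i, ((τ i : ℤ) : ℝ) * f g (x i)| ≤ Fintype.card (Fin n) * B :=
    fun τ x g => abs_sum_le_card_mul fun i => by
      rw [abs_unit_mul]
      exact hB _ _
  have hp1 : MeasurePreserving (fun (z : Fin n → Y × Y) i => (z i).1)
      (Measure.pi fun _ : Fin n => μ.prod μ) (Measure.pi fun _ : Fin n => μ) :=
    measurePreserving_pi (fun _ : Fin n => μ.prod μ) (fun _ : Fin n => μ)
      fun _ => measurePreserving_fst
  have hp2 : MeasurePreserving (fun (z : Fin n → Y × Y) i => (z i).2)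
      (Measure.pi fun _ : Fin n => μ.prod μ) (Measure.pi fun _ : Fin n => μ) :=
    measurePreserving_pi (fun _ : Fin n => μ.prod μ) (fun _ : Fin n => μ)
      fun _ => measurePreserving_snd
  have hsw : MeasurePreserving
      (fun (z : Fin n → Y × Y) i => (if σ i = 1 then id else Prod.swap) (z i))
      (Measure.pi fun _ : Fin n => μ.prod μ) (Measure.pi fun _ : Fin n => μ.prod μ) :=
    measurePreserving_pi (fun _ : Fin n => μ.prod μ) (fun _ : Fin n => μ.prod μ) fun i => by
      split_ifs
      exacts [MeasurePreserving.id _, Measure.measurePreserving_swap]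
  have hsm : Measurable fun z : Fin n → Y × Y => ⨆ g, ∑ i, (f g (z i).1 - f g (z i).2) :=
    Measurable.iSup fun g => Finset.measurable_sum _ fun i _ => (hf1 g i).sub (hf2 g i)
  rw [← MeasurePreserving.integral_comp_measurable hsw hsm,
    ← MeasurePreserving.integral_comp_measurable hp1 (hm σ),
    ← MeasurePreserving.integral_comp_measurable hp2 (hm (-σ)), ← integral_add]
  rotate_left
  · exact integrable_of_abs_le ((hm σ).comp hp1.measurable) fun z =>
      abs_iSup_le_of_abs_le (hb σ fun i => (z i).1)
  · exact integrable_of_abs_le ((hm (-σ)).comp hp2.measurable) fun z =>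
      abs_iSup_le_of_abs_le (hb (-σ) fun i => (z i).2)
  have e : ∀ (z : Fin n → Y × Y) g i,
      f g ((if σ i = 1 then id else Prod.swap) (z i)).1 -
        f g ((if σ i = 1 then id else Prod.swap) (z i)).2 =
      ((σ i : ℤ) : ℝ) * f g (z i).1 + (((-σ) i : ℤ) : ℝ) * f g (z i).2 := by
    intro z g i
    rcases Int.units_eq_one_or (σ i) with h | h
    · simp [h, sub_eq_add_neg]
    · simp [h, show (-1 : ℤˣ) ≠ 1 by decide]
      ring
  simp only [e, Finset.sum_add_distrib]
  have hb1 := fun z : Fin n → Y × Y => hb σ fun i => (z i).1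
  have hb2 := fun z : Fin n → Y × Y => hb (-σ) fun i => (z i).2
  refine integral_mono (integrable_of_abs_le
      (B := Fintype.card (Fin n) * B + Fintype.card (Fin n) * B)
      (Measurable.iSup fun g => (Finset.measurable_sum _ fun i _ => (hf1 g i).const_mul _).add
        (Finset.measurable_sum _ fun i _ => (hf2 g i).const_mul _))
      fun z => abs_iSup_le_of_abs_le fun g =>
        (abs_add_le _ _).trans (add_le_add (hb1 z g) (hb2 z g)))
    (integrable_of_abs_le (B := Fintype.card (Fin n) * B + Fintype.card (Fin n) * B)
      (((hm σ).comp hp1.measurable).add ((hm (-σ)).comp hp2.measurable))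
      fun z => (abs_add_le _ _).trans
        (add_le_add (abs_iSup_le_of_abs_le (hb1 z)) (abs_iSup_le_of_abs_le (hb2 z))))
    fun z => ciSup_le fun g => add_le_add
      (le_ciSup (bddAbove_of_abs_le (hb1 z)) g) (le_ciSup (bddAbove_of_abs_le (hb2 z)) g)

/-- **Symmetrization**: the expected uniform deviation is at most twice the expected Rademacher
average. -/
theorem integral_iSup_deviation_le_rademacher (hf : ∀ g, Measurable (f g))
    (hB : ∀ g y, |f g y| ≤ B) :
    ∫ x, ⨆ g, ∑ i, (∫ y, f g y ∂μ - f g (x i)) ∂(Measure.pi fun _ : Fin n => μ) ≤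
      2 * ((1 / 2 ^ n) * ∑ σ : Fin n → ℤˣ,
        ∫ x, ⨆ g, ∑ i, ((σ i : ℤ) : ℝ) * f g (x i) ∂(Measure.pi fun _ : Fin n => μ)) := by
  set D := ∫ z : Fin n → Y × Y, ⨆ g, ∑ i, (f g (z i).1 - f g (z i).2)
    ∂(Measure.pi fun _ : Fin n => μ.prod μ)
  have h := Finset.sum_le_sum fun σ (_ : σ ∈ Finset.univ) =>
    integral_iSup_signed_difference_le μ n hf hB σ
  -- Negation permutes the sign vectors, so after summation over σ both halves are equal; this is
  -- the factor 2.
  have hneg := Equiv.sum_comp (Equiv.neg (Fin n → ℤˣ)) fun τ => ∫ x, ⨆ g, ∑ i,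
    ((τ i : ℤ) : ℝ) * f g (x i) ∂(Measure.pi fun _ : Fin n => μ)
  simp only [Equiv.neg_apply] at hneg
  rw [Finset.sum_add_distrib, hneg, Finset.sum_const,
    Finset.card_univ, Fintype.card_fun, Fintype.card_fin, Fintype.card_units_int,
    nsmul_eq_mul] at h
  refine (integral_iSup_deviation_le μ n hf hB).trans ?_
  have h2 : (0 : ℝ) < 2 ^ n := by positivity
  change D ≤ _
  push_cast at h
  rw [one_div, mul_left_comm, ← div_eq_inv_mul, le_div_iff₀ h2]
  linarith

end Symm

section

/-! ### Uniform deviation of pairwise empirical averages -/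

variable {X : Type*} [MeasurableSpace X]

@[fun_prop]
theorem measurable_inst (t : Bool) : Measurable (inst t : X × X → X) := by
  cases t
  · exact measurable_snd
  · exact measurable_fst

/-- The sum over the two positions of `k t * h (g x^t)`. -/
def pairFn (k : Bool → ℝ) (h : ℝ → ℝ) (g : X → ℝ) (z : X × X) : ℝ :=
  ∑ t : Bool, k t * h (g (inst t z))

theorem measurable_pairFn {k : Bool → ℝ} {h : ℝ → ℝ} (hh : Measurable h) {g : X → ℝ}
    (hg : Measurable g) : Measurable (pairFn k h g) :=
  Finset.measurable_sum _ fun t _ => (hh.comp (hg.comp (measurable_inst t))).const_mul _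

theorem abs_sum_mul_le {k a : Bool → ℝ} {C : ℝ} (h : ∀ t, |a t| ≤ C) :
    |∑ t, k t * a t| ≤ (∑ t, |k t|) * C := by
  rw [Finset.sum_mul]
  refine (Finset.abs_sum_le_sum_abs _ _).trans (Finset.sum_le_sum fun t _ => ?_)
  rw [abs_mul]
  exact mul_le_mul_of_nonneg_left (h t) (abs_nonneg _)

theorem abs_pairFn_le {k : Bool → ℝ} {h : ℝ → ℝ} {g : X → ℝ} {C : ℝ} (hC : ∀ x, |h (g x)| ≤ C)
    (z : X × X) : |pairFn k h g z| ≤ (∑ t, |k t|) * C :=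
  abs_sum_mul_le fun _ => hC _

theorem abs_pairFn_sub_le {k : Bool → ℝ} {h : ℝ → ℝ} {g : X → ℝ} {C : ℝ}
    (hC : ∀ x y, |h (g x) - h (g y)| ≤ C) (z w : X × X) :
    |pairFn k h g z - pairFn k h g w| ≤ (∑ t, |k t|) * C := by
  unfold pairFn
  rw [← Finset.sum_sub_distrib]
  simp_rw [← mul_sub]
  exact abs_sum_mul_le fun _ => hC _ _

variable {G : Set (X → ℝ)} {Cg : ℝ}

/-- Links the unnormalized Rademacher sums of the symmetrization step to `rademacher`; used with `T
= inst t`, so that the complexity is taken under an instance marginal of the pair law. -/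
theorem rademacher_sum_eq [Countable G] (hGm : ∀ g ∈ G, Measurable g) {n : ℕ} (hn : 0 < n)
    {Y : Type*} [MeasurableSpace Y] (Q : Measure Y) [IsProbabilityMeasure Q] {T : Y → X}
    (hT : Measurable T) :
    ∫ x : Fin n → Y, ∑ σ : Fin n → ℤˣ, ⨆ g : G, ∑ i, ((σ i : ℤ) : ℝ) * (g : X → ℝ) (T (x i))
        ∂(Measure.pi fun _ : Fin n => Q) =
      2 ^ n * (n * rademacher G n (Q.map T)) := by
  have := Measure.isProbabilityMeasure_map (μ := Q) hT.aemeasurable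
  have hn' : (n : ℝ) ≠ 0 := by exact_mod_cast hn.ne'
  have hp : MeasurePreserving (fun (x : Fin n → Y) i => T (x i))
      (Measure.pi fun _ : Fin n => Q) (Measure.pi fun _ : Fin n => Q.map T) :=
    measurePreserving_pi (fun _ : Fin n => Q) (fun _ : Fin n => Q.map T)
      fun _ => ⟨hT, rfl⟩
  have hm : Measurable fun x : Fin n → X => ∑ σ : Fin n → ℤˣ, ⨆ g : G, ∑ i,
      ((σ i : ℤ) : ℝ) * (g : X → ℝ) (x i) :=
    Finset.measurable_sum _ fun σ _ => Measurable.iSup fun g => Finset.measurable_sum _ fun i _ =>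
      ((hGm g g.2).comp (measurable_pi_apply i)).const_mul _
  rw [MeasurePreserving.integral_comp_measurable hp hm, rademacher]
  simp_rw [← Real.mul_iSup_of_nonneg (show (0 : ℝ) ≤ 1 / n by positivity), ← Finset.mul_sum]
  rw [integral_const_mul, integral_const_mul]
  field_simp

/-- The supremum of a sum over the two positions is at most the sum of the suprema, and contraction
removes `h` in each. The suprema carry no absolute value, so `h 0 = 0` is not needed and no factor 2
is lost. -/
theorem sum_iSup_signs_pairFn_le [Nonempty G] (hCg : ∀ g ∈ G, ∀ x, |g x| ≤ Cg)
    (k : Bool → ℝ) {h : ℝ → ℝ} {L C : ℝ} (hL0 : 0 ≤ L)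
    (hL : ∀ z z', |h z - h z'| ≤ L * |z - z'|) (hC : ∀ z, |z| ≤ Cg → |h z| ≤ C) {n : ℕ}
    (x : Fin n → X × X) :
    ∑ σ : Fin n → ℤˣ, ⨆ g : G, ∑ i, ((σ i : ℤ) : ℝ) * pairFn k h (g : X → ℝ) (x i) ≤
      ∑ t, |k t| * L * ∑ σ : Fin n → ℤˣ, ⨆ g : G, ∑ i,
        ((σ i : ℤ) : ℝ) * (g : X → ℝ) (inst t (x i)) := by
  have hkC : ∀ t (g : G) (i : Fin n), |k t * h ((g : X → ℝ) (inst t (x i)))| ≤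
      (|k true| + |k false|) * C := fun t g i => by
    have h0 := hC _ (hCg g g.2 (inst t (x i)))
    rw [abs_mul]
    refine mul_le_mul ?_ h0 (abs_nonneg _) (by positivity)
    cases t <;> simp
  have hkL : ∀ t (g : G) (i : Fin n), |(|k t| * L) * (g : X → ℝ) (inst t (x i))| ≤
      (|k true| + |k false|) * L * Cg := fun t g i => by
    have h0 := hCg g g.2 (inst t (x i))
    rw [abs_mul, abs_mul, abs_abs, abs_of_nonneg hL0]
    refine mul_le_mul (mul_le_mul_of_nonneg_right ?_ hL0) h0 (abs_nonneg _) (by positivity)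
    cases t <;> simp
  calc ∑ σ : Fin n → ℤˣ, ⨆ g : G, ∑ i, ((σ i : ℤ) : ℝ) * pairFn k h (g : X → ℝ) (x i)
      ≤ ∑ σ : Fin n → ℤˣ, ∑ t, ⨆ g : G, ∑ i,
          ((σ i : ℤ) : ℝ) * (k t * h ((g : X → ℝ) (inst t (x i)))) := by
        refine Finset.sum_le_sum fun σ _ => ciSup_le fun g => ?_
        simp only [pairFn, Finset.mul_sum]
        rw [Finset.sum_comm]
        exact Finset.sum_le_sum fun t _ => le_ciSup (f := fun g : G => ∑ i,
          ((σ i : ℤ) : ℝ) * (k t * h ((g : X → ℝ) (inst t (x i)))))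
          (bddAbove_of_abs_le fun g => abs_sum_le_card_mul fun i => by
            rw [abs_unit_mul]
            exact hkC t g i) g
    _ = ∑ t, ∑ σ : Fin n → ℤˣ, ⨆ g : G, ∑ i,
          ((σ i : ℤ) : ℝ) * (k t * h ((g : X → ℝ) (inst t (x i)))) := Finset.sum_comm
    _ ≤ ∑ t, ∑ σ : Fin n → ℤˣ, ⨆ g : G, ∑ i,
          ((σ i : ℤ) : ℝ) * ((|k t| * L) * (g : X → ℝ) (inst t (x i))) := by
        refine Finset.sum_le_sum fun t _ => ?_
        refine sum_iSup_signs_le_of_contraction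
          (v := fun i (g : G) => k t * h ((g : X → ℝ) (inst t (x i))))
          (u := fun i (g : G) => (|k t| * L) * (g : X → ℝ) (inst t (x i)))
          (B := max ((|k true| + |k false|) * C) ((|k true| + |k false|) * L * Cg))
          (fun i g => (hkC t g i).trans (le_max_left _ _))
          (fun i g => (hkL t g i).trans (le_max_right _ _)) fun i g g' => ?_
        rw [← mul_sub, ← mul_sub, abs_mul, abs_mul, abs_mul, abs_abs, abs_of_nonneg hL0, mul_assoc]
        exact mul_le_mul_of_nonneg_left (hL _ _) (abs_nonneg _)
    _ = _ := by
        refine Finset.sum_congr rfl fun t _ => ?_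
        rw [Finset.mul_sum]
        refine Finset.sum_congr rfl fun σ _ => ?_
        rw [Real.mul_iSup_of_nonneg (by positivity)]
        simp only [Finset.mul_sum]
        refine iSup_congr fun g => Finset.sum_congr rfl fun i _ => ?_
        ring

theorem integral_iSup_pairFn_deviation_le [Countable G] [Nonempty G]
    (hGm : ∀ g ∈ G, Measurable g) (hCg : ∀ g ∈ G, ∀ x, |g x| ≤ Cg)
    (k : Bool → ℝ) {h : ℝ → ℝ} (hh : Measurable h) {L C R : ℝ} (hL0 : 0 ≤ L)
    (hL : ∀ z z', |h z - h z'| ≤ L * |z - z'|) (hC : ∀ z, |z| ≤ Cg → |h z| ≤ C) {n : ℕ}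
    (hn : 0 < n) (Q : Measure (X × X)) [IsProbabilityMeasure Q]
    (hR : ∀ t, rademacher G n (Q.map (inst t)) ≤ R) :
    ∫ x, ⨆ g : G, ∑ i, (∫ z, pairFn k h (g : X → ℝ) z ∂Q - pairFn k h (g : X → ℝ) (x i))
        ∂(Measure.pi fun _ : Fin n => Q) ≤ n * ((∑ t, |k t|) * (2 * L * R)) := by
  have hfm : ∀ g : G, Measurable (pairFn k h (g : X → ℝ)) := fun g =>
    measurable_pairFn hh (hGm g g.2)
  have hfB : ∀ (g : G) z, |pairFn k h (g : X → ℝ) z| ≤ (∑ t, |k t|) * C := fun g =>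
    abs_pairFn_le fun x => hC _ (hCg g g.2 x)
  refine (integral_iSup_deviation_le_rademacher Q n hfm hfB).trans ?_
  have hi1 : ∀ σ : Fin n → ℤˣ, Integrable (fun x : Fin n → X × X => ⨆ g : G, ∑ i,
      ((σ i : ℤ) : ℝ) * pairFn k h (g : X → ℝ) (x i)) (Measure.pi fun _ : Fin n => Q) := fun σ =>
    integrable_of_abs_le (Measurable.iSup fun g => Finset.measurable_sum _ fun i _ =>
        ((hfm g).comp (measurable_pi_apply i)).const_mul _)
      fun x => abs_iSup_le_of_abs_le fun g => abs_sum_le_card_mul fun i => by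
        rw [abs_unit_mul]
        exact hfB g _
  have hi2 : ∀ t, Integrable (fun x : Fin n → X × X => ∑ σ : Fin n → ℤˣ, ⨆ g : G, ∑ i,
      ((σ i : ℤ) : ℝ) * (g : X → ℝ) (inst t (x i))) (Measure.pi fun _ : Fin n => Q) := fun t =>
    integrable_finsetSum _ fun σ _ =>
      integrable_of_abs_le (Measurable.iSup fun g => Finset.measurable_sum _ fun i _ =>
        ((hGm g g.2).comp ((measurable_inst t).comp (measurable_pi_apply i))).const_mul _)
      fun x => abs_iSup_le_of_abs_le fun g => abs_sum_le_card_mul fun i => by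
        rw [abs_unit_mul]
        exact hCg g g.2 _
  rw [← integral_finsetSum _ fun σ _ => hi1 σ]
  have hle := integral_mono (integrable_finsetSum _ fun σ _ => hi1 σ)
    (integrable_finsetSum _ fun t _ => (hi2 t).const_mul (|k t| * L))
    (fun x => sum_iSup_signs_pairFn_le hCg k hL0 hL hC x)
  rw [integral_finsetSum _ fun t _ => (hi2 t).const_mul (|k t| * L)] at hle
  simp_rw [integral_const_mul, rademacher_sum_eq hGm hn Q (measurable_inst _)] at hle
  have h2 : ∑ t, |k t| * L * (2 ^ n * (n * rademacher G n (Q.map (inst t)))) ≤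
      ∑ t, |k t| * L * (2 ^ n * (n * R)) :=
    Finset.sum_le_sum fun t _ => by
      gcongr
      exact hR t
  rw [← Finset.sum_mul, ← Finset.sum_mul] at h2
  have h3 := mul_le_mul_of_nonneg_left (hle.trans h2) (show (0 : ℝ) ≤ 2 * (1 / 2 ^ n) by positivity)
  rw [mul_assoc] at h3
  refine h3.trans (le_of_eq ?_)
  field_simp

end

/-! ### Concentration of the supremum, and passage from countable to separable classes. -/

section

variable {X : Type*} [MeasurableSpace X] {G : Set (X → ℝ)} {Cg : ℝ}

theorem measurable_iSup_pairFn_deviation [Countable G] (hGm : ∀ g ∈ G, Measurable g)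
    (k : Bool → ℝ) {h : ℝ → ℝ} (hh : Measurable h) {n : ℕ} (Q : Measure (X × X)) :
    Measurable fun x : Fin n → X × X =>
      ⨆ g : G, ∑ i, (∫ z, pairFn k h (g : X → ℝ) z ∂Q - pairFn k h (g : X → ℝ) (x i)) :=
  Measurable.iSup fun g => Finset.measurable_sum _ fun i _ =>
    ((measurable_pairFn hh (hGm g g.2)).comp (measurable_pi_apply i)).const_sub _

theorem measurable_sum_pairFn_deviation (k : Bool → ℝ) {h : ℝ → ℝ} (hh : Measurable h)
    {g : X → ℝ} (hg : Measurable g) {n : ℕ} (Q : Measure (X × X)) :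
    Measurable fun x : Fin n → X × X =>
      ∑ i, (∫ z, pairFn k h g z ∂Q - pairFn k h g (x i)) :=
  Finset.measurable_sum _ fun i _ =>
    ((measurable_pairFn hh hg).comp (measurable_pi_apply i)).const_sub _

theorem abs_sum_sub_sum_update_le {Y : Type*} {n : ℕ} (F : Y → ℝ) {K : ℝ}
    (hF : ∀ y y', |F y - F y'| ≤ K) (x : Fin n → Y) (i : Fin n) (y : Y) :
    |∑ j, F (x j) - ∑ j, F (Function.update x i y j)| ≤ K := by
  rw [← Finset.sum_sub_distrib, Finset.sum_eq_single i]
  · simpa using hF (x i) y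
  · intro j _ hj
    simp [Function.update_of_ne hj]
  · simp

theorem abs_iSup_sub_iSup_le {Γ : Type*} [Nonempty Γ] {a b : Γ → ℝ} {K : ℝ}
    (ha : BddAbove (Set.range a)) (hb : BddAbove (Set.range b)) (h : ∀ g, |a g - b g| ≤ K) :
    |(⨆ g, a g) - ⨆ g, b g| ≤ K := by
  rw [abs_sub_le_iff]
  constructor
  · rw [sub_le_iff_le_add]
    refine ciSup_le fun g => ?_
    have := le_ciSup hb g
    have := (abs_sub_le_iff.1 (h g)).1
    linarith
  · rw [sub_le_iff_le_add]
    refine ciSup_le fun g => ?_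
    have := le_ciSup ha g
    have := (abs_sub_le_iff.1 (h g)).2
    linarith

/-- Uniform deviation over a countable class, relative to a reference function. -/
theorem measureReal_uniform_deviation_le [Countable G] [Nonempty G]
    (hGm : ∀ g ∈ G, Measurable g) (hCg : ∀ g ∈ G, ∀ x, |g x| ≤ Cg)
    {gs : X → ℝ} (hgs : Measurable gs) (hCs : ∀ x, |gs x| ≤ Cg)
    (k : Bool → ℝ) {h : ℝ → ℝ} (hh : Measurable h) {L C R δ : ℝ} (hL0 : 0 ≤ L)
    (hL : ∀ z z', |h z - h z'| ≤ L * |z - z'|) (hC0 : 0 ≤ C) (hC : ∀ z, |z| ≤ Cg → |h z| ≤ C)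
    (hosc : ∀ z z', |z| ≤ Cg → |z'| ≤ Cg → |h z - h z'| ≤ C) {n : ℕ}
    (hn : 0 < n) (Q : Measure (X × X)) [IsProbabilityMeasure Q]
    (hR : ∀ t, rademacher G n (Q.map (inst t)) ≤ R) (hδ : 0 < δ) (hδ1 : δ ≤ 1) :
    (Measure.pi fun _ : Fin n => Q).real
      {x | n * ((∑ t, |k t|) * (2 * L * R)) +
            2 * (∑ t, |k t|) * C * √(n * Real.log (1 / δ) / 2) <
          (⨆ g : G, ∑ i, (∫ z, pairFn k h (g : X → ℝ) z ∂Q - pairFn k h (g : X → ℝ) (x i))) -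
            ∑ i, (∫ z, pairFn k h gs z ∂Q - pairFn k h gs (x i))} ≤ δ := by
  set K := ∑ t, |k t| with hK
  have hK0 : 0 ≤ K := Finset.sum_nonneg fun t _ => abs_nonneg _
  have hbd : ∀ (g : X → ℝ), (∀ x, |g x| ≤ Cg) → ∀ z,
      |∫ z, pairFn k h g z ∂Q - pairFn k h g z| ≤ 2 * (K * C) := fun g hg z => by
    have h1 := abs_integral_le_of_abs_le (μ := Q)
      (abs_pairFn_le (k := k) fun x => hC _ (hg x))
    have h2 := abs_pairFn_le (k := k) (fun x => hC _ (hg x)) z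
    refine (abs_sub _ _).trans ?_
    linarith
  have hosc' : ∀ (g : X → ℝ), (∀ x, |g x| ≤ Cg) → ∀ z w,
      |(∫ z, pairFn k h g z ∂Q - pairFn k h g z) - (∫ z, pairFn k h g z ∂Q - pairFn k h g w)| ≤
        K * C := fun g hg z w => by
    rw [sub_sub_sub_cancel_left]
    exact abs_pairFn_sub_le (k := k) (fun x y => hosc _ _ (hg x) (hg y)) w z
  have hSB : ∀ (g : X → ℝ), (∀ x, |g x| ≤ Cg) → ∀ x : Fin n → X × X,
      |∑ i, (∫ z, pairFn k h g z ∂Q - pairFn k h g (x i))| ≤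
        Fintype.card (Fin n) * (2 * (K * C)) := fun g hg x =>
    abs_sum_le_card_mul fun i => hbd g hg _
  have hm1 := measurable_iSup_pairFn_deviation (n := n) hGm k hh Q
  have hm2 := measurable_sum_pairFn_deviation (n := n) k hh hgs Q
  have hB1 : ∀ x : Fin n → X × X, |⨆ g : G, ∑ i, (∫ z, pairFn k h (g : X → ℝ) z ∂Q -
      pairFn k h (g : X → ℝ) (x i))| ≤ Fintype.card (Fin n) * (2 * (K * C)) := fun x =>
    abs_iSup_le_of_abs_le fun g => hSB g (hCg g g.2) x
  -- Changing one pair moves the supremum and the reference deviation by at most `K * C` each,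
  -- whence `2 * K * C`. Treating both in one function saves a second application of the inequality.
  have hmc := measureReal_pi_deviation_le Q hn (hm1.sub hm2)
    (B := Fintype.card (Fin n) * (2 * (K * C)) + Fintype.card (Fin n) * (2 * (K * C)))
    (c := 2 * K * C) (fun x => (abs_sub _ _).trans (add_le_add (hB1 x) (hSB gs hCs x)))
    (by positivity) (fun x i y => by
      have e1 := abs_iSup_sub_iSup_le (K := K * C)
        (bddAbove_of_abs_le fun g : G => hSB g (hCg g g.2) x)
        (bddAbove_of_abs_le fun g : G => hSB g (hCg g g.2) (Function.update x i y))
        fun g => abs_sum_sub_sum_update_le _ (hosc' g (hCg g g.2)) x i y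
      have e2 := abs_sum_sub_sum_update_le _ (hosc' gs hCs) x i y
      simp only [Pi.sub_apply]
      rw [sub_sub_sub_comm]
      refine (abs_sub _ _).trans ((add_le_add e1 e2).trans (le_of_eq (by ring)))) hδ hδ1
  have hexp := integral_iSup_pairFn_deviation_le hGm hCg k hh hL0 hL hC hn Q hR
  -- The reference function is fixed, so its deviation is centered and does not affect the mean.
  have hzero : ∫ x : Fin n → X × X, ∑ i, (∫ z, pairFn k h gs z ∂Q - pairFn k h gs (x i))
      ∂(Measure.pi fun _ : Fin n => Q) = 0 := by
    rw [integral_finsetSum]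
    · refine Finset.sum_eq_zero fun i _ => ?_
      have hmg := measurable_pairFn (k := k) hh hgs
      have hi : Integrable (fun x : Fin n → X × X => pairFn k h gs (x i))
          (Measure.pi fun _ : Fin n => Q) := integrable_of_abs_le
        (hmg.comp (measurable_pi_apply i)) fun x => abs_pairFn_le (fun x => hC _ (hCs x)) _
      rw [integral_sub (integrable_const _) hi,
        MeasurePreserving.integral_comp_measurable (measurePreserving_eval Q i) hmg]
      simp
    · exact fun i _ => integrable_of_abs_le (((measurable_pairFn hh hgs).comp
        (measurable_pi_apply i)).const_sub _) fun x => hbd gs hCs _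
  refine (measureReal_mono ?_ (measure_ne_top _ _)).trans hmc
  intro x hx
  have hint : ∫ x : Fin n → X × X, ((⨆ g : G, ∑ i, (∫ z, pairFn k h (g : X → ℝ) z ∂Q -
      pairFn k h (g : X → ℝ) (x i))) - ∑ i, (∫ z, pairFn k h gs z ∂Q - pairFn k h gs (x i)))
      ∂(Measure.pi fun _ : Fin n => Q) ≤ n * (K * (2 * L * R)) := by
    rw [integral_sub (integrable_of_abs_le hm1 hB1) (integrable_of_abs_le hm2 (hSB gs hCs)),
      hzero, sub_zero]
    exact hexp
  simp only [Set.mem_ofPred_eq, Pi.sub_apply] at hx ⊢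
  linarith

/-! ### Pointwise separable classes -/

/-- A functional continuous along pointwise limits has the same supremum over the countable subset
as over the whole class. -/
theorem iSup_eq_iSup_of_separable {G₀ : Set (X → ℝ)} (h0 : G₀ ⊆ G) [Nonempty G₀] [Nonempty G]
    (hd : ∀ g ∈ G, ∃ u : ℕ → X → ℝ, (∀ k, u k ∈ G₀) ∧
      ∀ x, Tendsto (fun k => u k x) atTop (𝓝 (g x)))
    {Φ : (X → ℝ) → ℝ} (hΦ : ∀ (u : ℕ → X → ℝ) (g : X → ℝ),
      (∀ x, Tendsto (fun k => u k x) atTop (𝓝 (g x))) →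
      Tendsto (fun k => Φ (u k)) atTop (𝓝 (Φ g)))
    (hbd : BddAbove (Set.range fun g : G => Φ g)) :
    ⨆ g : G₀, Φ g = ⨆ g : G, Φ g := by
  have hbd0 : BddAbove (Set.range fun g : G₀ => Φ g) :=
    hbd.mono (by rintro _ ⟨g, rfl⟩; exact ⟨⟨g, h0 g.2⟩, rfl⟩)
  refine le_antisymm (ciSup_le fun g => le_ciSup (f := fun g : G => Φ g) hbd ⟨g, h0 g.2⟩)
    (ciSup_le fun g => ?_)
  obtain ⟨u, hu, hug⟩ := hd g g.2
  exact le_of_tendsto' (hΦ u g hug) fun k =>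
    le_ciSup (f := fun g : G₀ => Φ g) hbd0 ⟨u k, hu k⟩

theorem rademacher_eq_of_separable {G₀ : Set (X → ℝ)} (h0 : G₀ ⊆ G) [Nonempty G₀] [Nonempty G]
    (hd : ∀ g ∈ G, ∃ u : ℕ → X → ℝ, (∀ k, u k ∈ G₀) ∧
      ∀ x, Tendsto (fun k => u k x) atTop (𝓝 (g x)))
    (hCg : ∀ g ∈ G, ∀ x, |g x| ≤ Cg) (n : ℕ) (μ : Measure X) :
    rademacher G₀ n μ = rademacher G n μ := by
  unfold rademacher
  refine integral_congr_ae (ae_of_all _ fun x => ?_)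
  simp only
  congr 1
  refine Finset.sum_congr rfl fun σ _ => ?_
  refine iSup_eq_iSup_of_separable h0 hd
    (Φ := fun g => (1 / (n : ℝ)) * ∑ i : Fin n, (((σ i : ℤˣ) : ℤ) : ℝ) * g (x i))
    (fun u g hu => (tendsto_finsetSum _ fun i _ => (hu (x i)).const_mul _).const_mul _)
    (bddAbove_of_abs_le (B := |1 / (n : ℝ)| * (Fintype.card (Fin n) * Cg)) fun g => ?_)
  rw [abs_mul]
  refine mul_le_mul_of_nonneg_left (abs_sum_le_card_mul fun i => ?_) (abs_nonneg _)
  rw [abs_unit_mul]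
  exact hCg g g.2 _

/-- **Uniform deviation** over a pointwise separable class, with high probability. -/
theorem exists_uniform_deviation
    (hGm : ∀ g ∈ G, Measurable g) (hGs : PointwiseSeparable G) (hCg : ∀ g ∈ G, ∀ x, |g x| ≤ Cg)
    {CG : ℝ} {gs : X → ℝ} (hgs : gs ∈ G)
    (k : Bool → ℝ) {h : ℝ → ℝ} {L C δ : ℝ} (hL0 : 0 ≤ L)
    (hL : ∀ z z', |h z - h z'| ≤ L * |z - z'|) (hC0 : 0 ≤ C) (hC : ∀ z, |z| ≤ Cg → |h z| ≤ C)
    (hosc : ∀ z z', |z| ≤ Cg → |z'| ≤ Cg → |h z - h z'| ≤ C) {n : ℕ}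
    (hn : 0 < n) (Q : Measure (X × X)) [IsProbabilityMeasure Q]
    (hCG : ∀ μ : Measure X, IsProbabilityMeasure μ → rademacher G n μ ≤ CG / √(n : ℝ))
    (hδ : 0 < δ) (hδ1 : δ ≤ 1) :
    ∃ E : Set (Fin n → X × X), MeasurableSet E ∧
      ENNReal.ofReal (1 - δ) ≤ (Measure.pi fun _ : Fin n => Q) E ∧
      ∀ x ∈ E, ∀ g ∈ G,
        (∫ z, pairFn k h g z ∂Q - (1 / n) * ∑ i, pairFn k h g (x i)) -
          (∫ z, pairFn k h gs z ∂Q - (1 / n) * ∑ i, pairFn k h gs (x i)) ≤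
        (∑ t, |k t|) * (2 * L * CG + C * √(2 * Real.log (1 / δ))) / √(n : ℝ) := by
  obtain ⟨G₀, h0, hcount, hd⟩ := hGs
  have : Countable G₀ := hcount
  have hne : Nonempty G₀ := by
    obtain ⟨u, hu, -⟩ := hd gs hgs
    exact ⟨⟨u 0, hu 0⟩⟩
  have hneG : Nonempty G := ⟨⟨gs, hgs⟩⟩
  have hcont : Continuous h := by
    have : LipschitzWith L.toNNReal h := LipschitzWith.of_dist_le_mul fun z z' => by
      simpa [Real.dist_eq, Real.coe_toNNReal L hL0] using hL z z'
    exact this.continuous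
  have hR : ∀ t, rademacher G₀ n (Q.map (inst t)) ≤ CG / √(n : ℝ) := fun t => by
    rw [rademacher_eq_of_separable h0 hd hCg]
    exact hCG _ (Measure.isProbabilityMeasure_map (measurable_inst t).aemeasurable)
  have hdev := measureReal_uniform_deviation_le (fun g hg => hGm g (h0 hg))
    (fun g hg => hCg g (h0 hg)) (hGm gs hgs) (hCg gs hgs) k hcont.measurable hL0 hL hC0 hC hosc
    hn Q hR hδ hδ1
  set T := n * ((∑ t, |k t|) * (2 * L * (CG / √(n : ℝ)))) +
    2 * (∑ t, |k t|) * C * √(n * Real.log (1 / δ) / 2) with hT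
  have hm1 := measurable_iSup_pairFn_deviation (n := n) (fun g hg => hGm g (h0 hg)) k
    hcont.measurable Q
  have hm2 := measurable_sum_pairFn_deviation (n := n) k hcont.measurable (hGm gs hgs) Q
  have hms : MeasurableSet {x : Fin n → X × X | T < (⨆ g : G₀, ∑ i,
      (∫ z, pairFn k h (g : X → ℝ) z ∂Q - pairFn k h (g : X → ℝ) (x i))) -
        ∑ i, (∫ z, pairFn k h gs z ∂Q - pairFn k h gs (x i))} :=
    measurableSet_lt measurable_const (hm1.sub hm2)
  refine ⟨_, hms.compl, ?_, fun x hx g hg => ?_⟩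
  · rw [prob_compl_eq_one_sub hms,
      ENNReal.ofReal_sub _ hδ.le, ENNReal.ofReal_one]
    refine tsub_le_tsub_left ?_ 1
    rw [measureReal_def] at hdev
    exact ENNReal.le_ofReal_iff_toReal_le (measure_ne_top _ _) hδ.le |>.2 hdev
  · have hn' : (0 : ℝ) < n := by exact_mod_cast hn
    have hx' := hx
    simp only [Set.mem_compl_iff, Set.mem_ofPred_eq, not_lt] at hx'
    -- The deviation passes to pointwise limits, its integral by dominated convergence; the
    -- countable supremum therefore controls every member of `G`.
    have hsum : ∑ i, (∫ z, pairFn k h g z ∂Q - pairFn k h g (x i)) ≤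
        ⨆ g : G₀, ∑ i, (∫ z, pairFn k h (g : X → ℝ) z ∂Q - pairFn k h (g : X → ℝ) (x i)) := by
      obtain ⟨u, hu, hug⟩ := hd g hg
      have hpt : ∀ z, Tendsto (fun m => pairFn k h (u m) z) atTop (𝓝 (pairFn k h g z)) := fun z =>
        tendsto_finsetSum _ fun t _ => ((hcont.tendsto _).comp (hug _)).const_mul _
      have hint : Tendsto (fun m => ∫ z, pairFn k h (u m) z ∂Q) atTop
          (𝓝 (∫ z, pairFn k h g z ∂Q)) :=
        tendsto_integral_of_dominated_convergence (fun _ => (∑ t, |k t|) * C)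
          (fun m => (measurable_pairFn hcont.measurable
            (hGm _ (h0 (hu m)))).aestronglyMeasurable) (integrable_const _)
          (fun m => ae_of_all _ fun z => abs_pairFn_le (fun x => hC _ (hCg _ (h0 (hu m)) x)) z)
          (ae_of_all _ hpt)
      refine le_of_tendsto' (tendsto_finsetSum _ fun i _ => hint.sub (hpt (x i))) fun m =>
        le_ciSup (f := fun g : G₀ => ∑ i, (∫ z, pairFn k h (g : X → ℝ) z ∂Q -
          pairFn k h (g : X → ℝ) (x i))) (bddAbove_of_abs_le
          (B := Fintype.card (Fin n) * ((∑ t, |k t|) * C + (∑ t, |k t|) * C)) fun g' =>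
            abs_sum_le_card_mul fun i => ?_) ⟨u m, hu m⟩
      have hb := fun z => abs_pairFn_le (k := k) (fun x => hC _ (hCg _ (h0 g'.2) x)) z
      exact (abs_sub _ _).trans (add_le_add (abs_integral_le_of_abs_le hb) (hb _))
    have hs : ∀ g : X → ℝ, ∑ i, (∫ z, pairFn k h g z ∂Q - pairFn k h g (x i)) =
        n * (∫ z, pairFn k h g z ∂Q - (1 / n) * ∑ i, pairFn k h g (x i)) := fun g => by
      rw [Finset.sum_sub_distrib, Finset.sum_const, Finset.card_univ, Fintype.card_fin,
        nsmul_eq_mul]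
      field_simp
    -- Rescaling to averages: √(n log(1/δ)/2) = √n · √(2 log(1/δ))/2, whose 1/2 cancels the 2 from
    -- the doubled oscillation.
    have hTn : T = n * ((∑ t, |k t|) * (2 * L * CG + C * √(2 * Real.log (1 / δ))) / √(n : ℝ)) := by
      have hlog : √(n * Real.log (1 / δ) / 2) = √n * √(2 * Real.log (1 / δ)) / 2 := by
        rw [← Real.sqrt_mul hn'.le, show n * Real.log (1 / δ) / 2 =
          (n * (2 * Real.log (1 / δ))) / 2 ^ 2 by ring, Real.sqrt_div' _ (by positivity),
          Real.sqrt_sq (by norm_num)]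
      have hsq : √(n : ℝ) * √(n : ℝ) = n := Real.mul_self_sqrt hn'.le
      have hs0 : 0 < √(n : ℝ) := Real.sqrt_pos.2 hn'
      rw [hT, hlog]
      field_simp
      linear_combination (∑ t, |k t|) * C * √(2 * Real.log (1 / δ)) * hsq
    rw [hs] at hsum hx'
    rw [hTn] at hx'
    refine le_of_mul_le_mul_left ?_ hn'
    rw [mul_sub]
    linarith

end

section

variable {X : Type*} [MeasurableSpace X]

/-! ### Integrals against the laws of the data -/

theorem integral_ofReal_smul_add {Ω : Type*} [MeasurableSpace Ω] (μ ν : Measure Ω)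
    [IsProbabilityMeasure μ] [IsProbabilityMeasure ν] {c d : ℝ} (hc : 0 ≤ c) (hd : 0 ≤ d)
    {f : Ω → ℝ} (hf : Measurable f) {B : ℝ} (hB : ∀ x, |f x| ≤ B) :
    ∫ x, f x ∂(ENNReal.ofReal c • μ + ENNReal.ofReal d • ν) =
      c * ∫ x, f x ∂μ + d * ∫ x, f x ∂ν := by
  rw [integral_add_measure ((integrable_of_abs_le hf hB).smul_measure ENNReal.ofReal_ne_top)
    ((integrable_of_abs_le hf hB).smul_measure ENNReal.ofReal_ne_top),
    integral_smul_measure, integral_smul_measure, ENNReal.toReal_ofReal hc,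
    ENNReal.toReal_ofReal hd, smul_eq_mul, smul_eq_mul]

theorem isProbabilityMeasure_ofReal_smul_add {Ω : Type*} [MeasurableSpace Ω] (μ ν : Measure Ω)
    [IsProbabilityMeasure μ] [IsProbabilityMeasure ν] {c d : ℝ} (hc : 0 ≤ c) (hd : 0 ≤ d)
    (h : c + d = 1) :
    IsProbabilityMeasure (ENNReal.ofReal c • μ + ENNReal.ofReal d • ν) := by
  constructor
  simp [← ENNReal.ofReal_add hc hd, h]

theorem measurableSet_label (t : Bool) : MeasurableSet {z : X × Bool | z.2 = t} :=
  measurable_snd (measurableSet_singleton t)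

section Priors

variable (p : Measure (X × Bool)) [IsProbabilityMeasure p]

theorem prior_add : prior p true + prior p false = 1 := by
  have h : {z : X × Bool | z.2 = false} = {z : X × Bool | z.2 = true}ᶜ := by
    ext z
    simp
  rw [prior, prior, h, probReal_compl_eq_one_sub (measurableSet_label true)]
  ring

variable {p}

theorem isProbabilityMeasure_classCond {t : Bool} (ht : 0 < prior p t) :
    IsProbabilityMeasure (classCond p t) := by
  have h0 : p {z | z.2 = t} ≠ 0 := fun h => by simp [prior, measureReal_def, h] at ht
  have := cond_isProbabilityMeasure h0
  exact Measure.isProbabilityMeasure_map measurable_fst.aemeasurable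

theorem setIntegral_label {t : Bool} (ht : 0 < prior p t) {F : X × Bool → ℝ} (hF : Measurable F) :
    ∫ z in {z | z.2 = t}, F z ∂p = prior p t * ∫ x, F (x, t) ∂(classCond p t) := by
  have hFt : Measurable fun x => F (x, t) := hF.comp measurable_prodMk_right
  rw [classCond, integral_map measurable_fst.aemeasurable hFt.aestronglyMeasurable,
    ProbabilityTheory.cond, integral_smul_measure, smul_eq_mul, ENNReal.toReal_inv,
    ← measureReal_def, ← mul_assoc]
  change _ = prior p t * (prior p t)⁻¹ * _
  rw [mul_inv_cancel₀ ht.ne', one_mul]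
  refine setIntegral_congr_fun (measurableSet_label t) fun z hz => ?_
  have hz' : z.2 = t := hz
  simp [← hz']

theorem risk_eq (hpos : 0 < prior p true) (hneg : 0 < prior p false) {ℓ : ℝ → Bool → ℝ}
    (hℓ : ∀ y, Measurable fun z => ℓ z y) {g : X → ℝ} (hg : Measurable g) {B : ℝ}
    (hB : ∀ x y, |ℓ (g x) y| ≤ B) :
    risk p ℓ g = prior p true * ∫ x, ℓ (g x) true ∂(classCond p true) +
      prior p false * ∫ x, ℓ (g x) false ∂(classCond p false) := by
  have hF : Measurable fun z : X × Bool => ℓ (g z.1) z.2 :=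
    measurable_from_prod_countable_left fun y => (hℓ y).comp hg
  have hc : {z : X × Bool | z.2 = true}ᶜ = {z : X × Bool | z.2 = false} := by
    ext z
    simp
  rw [risk, ← integral_add_compl (measurableSet_label true)
    (integrable_of_abs_le hF fun z => hB _ _), hc, setIntegral_label hpos hF,
    setIntegral_label hneg hF]

theorem integral_inst_prod (μ ν : Measure X) [IsProbabilityMeasure μ] [IsProbabilityMeasure ν]
    {f : X → ℝ} (hf : Measurable f) (t : Bool) :
    ∫ z, f (inst t z) ∂(μ.prod ν) = if t then ∫ x, f x ∂μ else ∫ x, f x ∂ν := by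
  cases t
  · exact MeasurePreserving.integral_comp_measurable (measurePreserving_snd (μ := μ) (ν := ν)) hf
  · exact MeasurePreserving.integral_comp_measurable (measurePreserving_fst (μ := μ) (ν := ν)) hf

theorem priorS_pos {p : Measure (X × Bool)} (hpos : 0 < prior p true) : 0 < priorS p := by
  unfold priorS
  positivity

theorem priorD_pos {p : Measure (X × Bool)} (hpos : 0 < prior p true) (hneg : 0 < prior p false) :
    0 < priorD p := by
  unfold priorD
  positivity

/-- Integral of an instance of a similar pair. -/
noncomputable def meanS (p : Measure (X × Bool)) (u : Bool → ℝ) : ℝ :=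
  (prior p true ^ 2 * u true + prior p false ^ 2 * u false) / priorS p

/-- Integral of an instance of a dissimilar pair. -/
noncomputable def meanD (u : Bool → ℝ) : ℝ := (u true + u false) / 2

/-- Integral against a comparison law. -/
noncomputable def meanC (p : Measure (X × Bool)) (u : Bool → ℝ) : Bool → ℝ
  | true => (prior p true * u true + prior p false ^ 2 * u false) /
      (prior p false ^ 2 + prior p true)
  | false => (prior p true ^ 2 * u true + prior p false * u false) /
      (prior p true ^ 2 + prior p false)

theorem integral_pairS
    (hpos : 0 < prior p true) (hneg : 0 < prior p false) {f : X → ℝ} (hf : Measurable f) {B : ℝ} (hB : ∀ x, |f x| ≤ B) (t : Bool) :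
    ∫ z, f (inst t z) ∂(pairS p) = meanS p fun y => ∫ x, f x ∂(classCond p y) := by
  have := isProbabilityMeasure_classCond hpos
  have := isProbabilityMeasure_classCond hneg
  have hS := priorS_pos hpos
  have hfi : Measurable fun z => f (inst t z) := hf.comp (measurable_inst t)
  rw [pairS, integral_ofReal_smul_add _ _ (by positivity) (by positivity) hfi (fun z => hB _), integral_inst_prod _ _ hf,
    integral_inst_prod _ _ hf, meanS]
  simp only [ite_self]
  ring

theorem integral_pairD
    (hpos : 0 < prior p true) (hneg : 0 < prior p false) {f : X → ℝ} (hf : Measurable f) {B : ℝ} (hB : ∀ x, |f x| ≤ B) (t : Bool) :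
    ∫ z, f (inst t z) ∂(pairD p) = meanD fun y => ∫ x, f x ∂(classCond p y) := by
  have := isProbabilityMeasure_classCond hpos
  have := isProbabilityMeasure_classCond hneg
  have hfi : Measurable fun z => f (inst t z) := hf.comp (measurable_inst t)
  rw [pairD, integral_ofReal_smul_add _ _ (by positivity) (by positivity) hfi (fun z => hB _), integral_inst_prod _ _ hf,
    integral_inst_prod _ _ hf, meanD]
  cases t <;> simp <;> ring

theorem integral_pcompLaw
    (hpos : 0 < prior p true) (hneg : 0 < prior p false) {f : X → ℝ} (hf : Measurable f) {B : ℝ} (hB : ∀ x, |f x| ≤ B)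
    (t : Bool) :
    ∫ x, f x ∂(pcompLaw p t) = meanC p (fun y => ∫ x, f x ∂(classCond p y)) t := by
  have := isProbabilityMeasure_classCond hpos
  have := isProbabilityMeasure_classCond hneg
  cases t
  · rw [pcompLaw, integral_ofReal_smul_add _ _ (by positivity) (by positivity) hf hB, meanC]
    ring
  · rw [pcompLaw, integral_ofReal_smul_add _ _ (by positivity) (by positivity) hf hB, meanC]
    ring

theorem isProbabilityMeasure_pcompLaw
    (hpos : 0 < prior p true) (hneg : 0 < prior p false) (t : Bool) : IsProbabilityMeasure (pcompLaw p t) := by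
  have := isProbabilityMeasure_classCond hpos
  have := isProbabilityMeasure_classCond hneg
  cases t
  · exact isProbabilityMeasure_ofReal_smul_add _ _ (by positivity) (by positivity) (by field_simp)
  · refine isProbabilityMeasure_ofReal_smul_add _ _ (by positivity) (by positivity) ?_
    field_simp
    ring

theorem isProbabilityMeasure_pairS
    (hpos : 0 < prior p true) (hneg : 0 < prior p false) : IsProbabilityMeasure (pairS p) := by
  have := isProbabilityMeasure_classCond hpos
  have := isProbabilityMeasure_classCond hneg
  have hS := priorS_pos hpos
  refine isProbabilityMeasure_ofReal_smul_add _ _ (by positivity) (by positivity) ?_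
  rw [← add_div]
  exact div_self hS.ne'

theorem isProbabilityMeasure_pairD
    (hpos : 0 < prior p true) (hneg : 0 < prior p false) : IsProbabilityMeasure (pairD p) := by
  have := isProbabilityMeasure_classCond hpos
  have := isProbabilityMeasure_classCond hneg
  exact isProbabilityMeasure_ofReal_smul_add _ _ (by positivity) (by positivity) (by norm_num)

theorem integral_of_map_eq
    (hpos : 0 < prior p true) (hneg : 0 < prior p false) {q κ : Measure (X × X)} [IsProbabilityMeasure q] {w : ℝ} (h0 : 0 ≤ w)
    (h1 : w ≤ 1) {t : Bool} (hκ : κ.map (inst t) =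
      ENNReal.ofReal w • pcompLaw p t + ENNReal.ofReal (1 - w) • q.map (inst t))
    {f : X → ℝ} (hf : Measurable f) {B : ℝ} (hB : ∀ x, |f x| ≤ B) :
    ∫ z, f (inst t z) ∂κ = w * meanC p (fun y => ∫ x, f x ∂(classCond p y)) t +
      (1 - w) * ∫ z, f (inst t z) ∂q := by
  have := isProbabilityMeasure_pcompLaw hpos hneg t
  have := Measure.isProbabilityMeasure_map (μ := q) (measurable_inst t).aemeasurable
  rw [← integral_map (measurable_inst t).aemeasurable hf.aestronglyMeasurable, hκ,
    integral_ofReal_smul_add _ _ h0 (sub_nonneg.2 h1) hf hB, integral_pcompLaw hpos hneg hf hB,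
    integral_map (measurable_inst t).aemeasurable hf.aestronglyMeasurable]

/-- The position means of a clean similar pair. -/
theorem IsCleanPairLaw.exists_integral_pairS
    (hpos : 0 < prior p true) (hneg : 0 < prior p false) {κ : Measure (X × X)}
    (hκ : IsCleanPairLaw p (pairS p) κ) :
    ∃ w : ℝ, 0 ≤ w ∧ w ≤ 1 ∧ ∀ (t : Bool) (f : X → ℝ), Measurable f →
      ∀ B : ℝ, (∀ x, |f x| ≤ B) → ∫ z, f (inst t z) ∂κ =
        w * meanC p (fun y => ∫ x, f x ∂(classCond p y)) t +
          (1 - w) * meanS p fun y => ∫ x, f x ∂(classCond p y) := by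
  obtain ⟨w, h0, h1, h⟩ := hκ
  have := isProbabilityMeasure_pairS hpos hneg
  refine ⟨w, h0, h1, fun t f hf B hB => ?_⟩
  rw [integral_of_map_eq hpos hneg h0 h1 (h t) hf hB, integral_pairS hpos hneg hf hB]

/-- The position means of a clean dissimilar pair. -/
theorem IsCleanPairLaw.exists_integral_pairD
    (hpos : 0 < prior p true) (hneg : 0 < prior p false) {κ : Measure (X × X)}
    (hκ : IsCleanPairLaw p (pairD p) κ) :
    ∃ w : ℝ, 0 ≤ w ∧ w ≤ 1 ∧ ∀ (t : Bool) (f : X → ℝ), Measurable f →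
      ∀ B : ℝ, (∀ x, |f x| ≤ B) → ∫ z, f (inst t z) ∂κ =
        w * meanC p (fun y => ∫ x, f x ∂(classCond p y)) t +
          (1 - w) * meanD fun y => ∫ x, f x ∂(classCond p y) := by
  obtain ⟨w, h0, h1, h⟩ := hκ
  have := isProbabilityMeasure_pairD hpos hneg
  refine ⟨w, h0, h1, fun t f hf B hB => ?_⟩
  rw [integral_of_map_eq hpos hneg h0 h1 (h t) hf hB, integral_pairD hpos hneg hf hB]

end Priors

/-! ### Noisy pairs -/

theorem isProbabilityMeasure_noisyCompare {ρC : ℝ} (h0 : 0 ≤ ρC) (h1 : ρC < 1)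
    (Q : Measure (X × X)) [IsProbabilityMeasure Q] :
    IsProbabilityMeasure (noisyCompare ρC Q) := by
  have := Measure.isProbabilityMeasure_map (μ := Q) measurable_swap.aemeasurable
  exact isProbabilityMeasure_ofReal_smul_add _ _ (by linarith) h0 (by ring)

theorem integral_pairFn (κ : Measure (X × X)) [IsProbabilityMeasure κ] (k : Bool → ℝ)
    {h : ℝ → ℝ} (hh : Measurable h) {g : X → ℝ} (hg : Measurable g) {B : ℝ}
    (hB : ∀ x, |h (g x)| ≤ B) :
    ∫ z, pairFn k h g z ∂κ = ∑ t, k t * ∫ z, h (g (inst t z)) ∂κ := by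
  unfold pairFn
  have hi : ∀ t, Integrable (fun z => h (g (inst t z))) κ := fun t => integrable_of_abs_le
    (hh.comp (hg.comp (measurable_inst t))) fun z => hB _
  rw [integral_finsetSum _ fun t _ => (hi t).const_mul _]
  exact Finset.sum_congr rfl fun t _ => integral_const_mul _ _

/-- A swap of the instances is moved onto the weights, as `k (!t)`. The general mixture θ, η serves
both observed labels. -/
theorem integral_pairFn_noisyCompare {ρC : ℝ} (h0 : 0 ≤ ρC) (h1 : ρC < 1) {θ η : ℝ} (hθ : 0 ≤ θ)
    (hη : 0 ≤ η) (hθη : θ + η = 1) (κ₁ κ₂ : Measure (X × X)) [IsProbabilityMeasure κ₁]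
    [IsProbabilityMeasure κ₂] (k : Bool → ℝ) {h : ℝ → ℝ} (hh : Measurable h) {g : X → ℝ}
    (hg : Measurable g) {B : ℝ} (hB : ∀ x, |h (g x)| ≤ B) :
    ∫ z, pairFn k h g z ∂(noisyCompare ρC (ENNReal.ofReal θ • κ₁ + ENNReal.ofReal η • κ₂)) =
      (1 - ρC) * (θ * ∑ t, k t * ∫ z, h (g (inst t z)) ∂κ₁ +
        η * ∑ t, k t * ∫ z, h (g (inst t z)) ∂κ₂) +
      ρC * (θ * ∑ t, k (!t) * ∫ z, h (g (inst t z)) ∂κ₁ +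
        η * ∑ t, k (!t) * ∫ z, h (g (inst t z)) ∂κ₂) := by
  have := isProbabilityMeasure_ofReal_smul_add κ₁ κ₂ hθ hη hθη
  have := Measure.isProbabilityMeasure_map
    (μ := ENNReal.ofReal θ • κ₁ + ENNReal.ofReal η • κ₂) measurable_swap.aemeasurable
  have hm : ∀ k : Bool → ℝ, Measurable (pairFn k h g) := fun k => measurable_pairFn hh hg
  have hswap : ∀ z, pairFn k h g (Prod.swap z) = pairFn (fun t => k (!t)) h g z := fun z => by
    simp [pairFn, inst, add_comm]
  rw [noisyCompare, integral_ofReal_smul_add _ _ (by linarith) h0 (hm k) (abs_pairFn_le hB),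
    integral_map measurable_swap.aemeasurable (hm k).aestronglyMeasurable]
  simp_rw [hswap]
  rw [integral_ofReal_smul_add _ _ hθ hη (hm _) (abs_pairFn_le hB),
    integral_ofReal_smul_add _ _ hθ hη (hm _) (abs_pairFn_le hB)]
  simp_rw [integral_pairFn _ _ hh hg hB]

end

section

variable {X : Type*} [MeasurableSpace X]

/-! ### The empirical risk as a pairwise average -/

/-- The loss to which the similar pairs contribute. -/
noncomputable def lossS (p : Measure (X × Bool)) (ℓ : ℝ → Bool → ℝ) (z : ℝ) : ℝ :=
  prior p true * ℓ z true - prior p false * ℓ z false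

/-- The loss to which the dissimilar pairs contribute. -/
noncomputable def lossD (p : Measure (X × Bool)) (ℓ : ℝ → Bool → ℝ) (z : ℝ) : ℝ :=
  prior p true * ℓ z false - prior p false * ℓ z true

/-- The weight of the instance in position `t` of a similar pair. -/
noncomputable def weightS (p : Measure (X × Bool)) (t : Bool) : ℝ :=
  prior p t ^ 2 / (prior p true - prior p false)

/-- The weight of the instance in position `t` of a dissimilar pair. -/
noncomputable def weightD (p : Measure (X × Bool)) (t : Bool) : ℝ :=
  (prior p (!t) - prior p t ^ 2) / (prior p true - prior p false)

theorem empRisk_eq (p : Measure (X × Bool)) (ℓ : ℝ → Bool → ℝ) {nS nD : ℕ} (d : Sample X nS nD)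
    (g : X → ℝ) :
    empRisk p ℓ d g = (1 / nS) * ∑ i, pairFn (weightS p) (lossS p ℓ) g (d.1 i) +
      (1 / nD) * ∑ i, pairFn (weightD p) (lossD p ℓ) g (d.2 i) := by
  unfold empRisk empRiskPart pairFn
  congr 1
  · rw [← Finset.mul_sum, Finset.sum_comm]
    congr 1
    refine Finset.sum_congr rfl fun i _ => Finset.sum_congr rfl fun t _ => ?_
    simp only [alphaS, weightS, lossS, if_true, Bool.false_eq_true, if_false]
    ring
  · rw [← Finset.mul_sum, Finset.sum_comm]
    congr 1
    refine Finset.sum_congr rfl fun i _ => Finset.sum_congr rfl fun t _ => ?_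
    simp only [alphaD, weightD, lossD, if_true, Bool.false_eq_true, if_false]
    ring

theorem abs_convex_sub_le {a b x y : ℝ} (ha : 0 < a) (hb : 0 < b) (hab : a + b = 1) {B : ℝ}
    (hx : |x| ≤ B) (hy : |y| ≤ B) : |a * x - b * y| ≤ B := by
  rw [abs_le] at *
  have hb' : b = 1 - a := by linarith
  constructor <;> nlinarith

theorem abs_convex_lipschitz_le {a b x y x' y' M : ℝ} (ha : 0 < a) (hb : 0 < b) (hab : a + b = 1)
    (hx : |x - x'| ≤ M) (hy : |y - y'| ≤ M) :
    |(a * x - b * y) - (a * x' - b * y')| ≤ M := by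
  have e : (a * x - b * y) - (a * x' - b * y') = a * (x - x') - b * (y - y') := by ring
  rw [e]
  exact abs_convex_sub_le ha hb hab hx hy

/-- Nonnegativity of the loss matters here: values in [0, C] differ by at most C, so the oscillation
is C and not 2C. -/
theorem abs_loss_sub_le {a b : ℝ} (ha : 0 < a) (hb : 0 < b) (hab : a + b = 1) {x y x' y' C : ℝ}
    (hx : 0 ≤ x ∧ x ≤ C) (hy : 0 ≤ y ∧ y ≤ C) (hx' : 0 ≤ x' ∧ x' ≤ C) (hy' : 0 ≤ y' ∧ y' ≤ C) :
    |(a * x - b * y) - (a * x' - b * y')| ≤ C :=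
  abs_convex_lipschitz_le ha hb hab
    (abs_le.2 ⟨by linarith [hx.1, hx'.2], by linarith [hx.2, hx'.1]⟩)
    (abs_le.2 ⟨by linarith [hy.1, hy'.2], by linarith [hy.2, hy'.1]⟩)

/-! ### Position means -/

section Means

variable {p : Measure (X × Bool)} [IsProbabilityMeasure p]

/-- Both comparison laws have the same normalizer, π_+² + π_- = π_-² + π_+ = 1 - π_+π_-. The
coefficients of u_+ and u_- are then this normalizer times π_+² and π_-². -/
theorem sum_sq_mul_meanC (hpos : 0 < prior p true) (hneg : 0 < prior p false) (u : Bool → ℝ) :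
    prior p true ^ 2 * meanC p u true + prior p false ^ 2 * meanC p u false =
      prior p true ^ 2 * u true + prior p false ^ 2 * u false := by
  have hab := prior_add p
  simp only [meanC]
  generalize prior p true = a at *
  generalize prior p false = b at *
  have hE : a ^ 2 + b = b ^ 2 + a := by linear_combination (a - b) * hab
  rw [hE]
  have : b ^ 2 + a ≠ 0 := by positivity
  field_simp
  linear_combination (b ^ 2 * u false) * hE

/-- Over the common normalizer 1 - π_+π_- the cubic terms cancel, and both coefficients become
π_+π_-(1 - π_+π_-). -/
theorem sum_weight_mul_meanC (hpos : 0 < prior p true) (hneg : 0 < prior p false)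
    (u : Bool → ℝ) :
    (prior p false - prior p true ^ 2) * meanC p u true +
      (prior p true - prior p false ^ 2) * meanC p u false =
      prior p true * prior p false * (u true + u false) := by
  have hab := prior_add p
  simp only [meanC]
  generalize prior p true = a at *
  generalize prior p false = b at *
  have hE : a ^ 2 + b = b ^ 2 + a := by linear_combination (a - b) * hab
  rw [hE]
  have : b ^ 2 + a ≠ 0 := by positivity
  field_simp
  obtain rfl : b = 1 - a := by linarith
  ring

/-- Decomposition of the risk into the clean-comparison part of the noisy risk and the bias that
label noise causes. -/
theorem risk_decomposition (hpos : 0 < prior p true) (hneg : 0 < prior p false)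
    (hne : prior p true ≠ prior p false) (u v m₁ m₂ r₁ r₂ : Bool → ℝ) {w₁ w₂ θS ηS θD ηD : ℝ}
    (hS : θS + ηS = 1) (hD : ηD + θD = 1)
    (hm₁ : ∀ t, m₁ t = w₁ * meanC p u t + (1 - w₁) * meanS p u)
    (hm₂ : ∀ t, m₂ t = w₂ * meanC p u t + (1 - w₂) * meanD u)
    (hr₁ : ∀ t, r₁ t = w₁ * meanC p v t + (1 - w₁) * meanS p v)
    (hr₂ : ∀ t, r₂ t = w₂ * meanC p v t + (1 - w₂) * meanD v) :
    (prior p true ^ 2 * u true + prior p false ^ 2 * u false +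
        prior p true * prior p false * (v true + v false)) / (prior p true - prior p false) =
      (θS * ∑ t, weightS p t * m₁ t + ηS * ∑ t, weightS p t * m₂ t) +
      (ηD * ∑ t, weightD p t * r₁ t + θD * ∑ t, weightD p t * r₂ t) +
      ηS * (1 - w₂) * ((u true - u false) / 2) -
      ηD * (1 - w₁) * (priorD p / priorS p) * ((v true - v false) / 2) := by
  have hab := prior_add p
  have hc : prior p true - prior p false ≠ 0 := sub_ne_zero.2 hne
  have hS0 : priorS p ≠ 0 := (priorS_pos hpos).ne'
  have e1 := sum_sq_mul_meanC hpos hneg u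
  have e2 := sum_weight_mul_meanC hpos hneg v
  have hSdef : priorS p = prior p true ^ 2 + prior p false ^ 2 := rfl
  have hDdef : priorD p = 2 * prior p true * prior p false := rfl
  have hms : ∀ u, priorS p * meanS p u = prior p true ^ 2 * u true + prior p false ^ 2 * u false :=
    fun u => by rw [meanS, mul_div_cancel₀ _ hS0]
  -- Correctly labelled similar pairs are unbiased: the squares π_t² sum to `priorS p`, the
  -- denominator of `meanS`.
  have f1 : ∑ t, weightS p t * m₁ t = (prior p true ^ 2 * u true + prior p false ^ 2 * u false) /
      (prior p true - prior p false) := by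
    rw [Fintype.sum_bool, hm₁, hm₁, weightS, weightS]
    field_simp
    linear_combination w₁ * e1 + (1 - w₁) * hms u - (1 - w₁) * meanS p u * hSdef
  -- Dissimilar pairs labelled similar: the comparison part is still exact, and the marginal part
  -- errs by half of (π_+² - π_-²)(u_+ - u_-)/(π_+ - π_-) = u_+ - u_-.
  have f2 : ∑ t, weightS p t * m₂ t = (prior p true ^ 2 * u true + prior p false ^ 2 * u false) /
      (prior p true - prior p false) - (1 - w₂) * ((u true - u false) / 2) := by
    rw [Fintype.sum_bool, hm₂, hm₂, weightS, weightS, meanD]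
    field_simp
    linear_combination 2 * w₂ * e1 -
      (1 - w₂) * (prior p true - prior p false) * (u true - u false) * hab
  have f3 : ∑ t, weightD p t * r₂ t = prior p true * prior p false * (v true + v false) /
      (prior p true - prior p false) := by
    rw [Fintype.sum_bool, hr₂, hr₂, weightD, weightD, meanD]
    simp only [Bool.not_true, Bool.not_false]
    field_simp
    linear_combination 2 * w₂ * e2 - (1 - w₂) * (v true + v false) *
      (prior p true + prior p false) * hab
  -- Similar pairs labelled dissimilar: the error is the analogous one for v, with the factor
  -- π_D/π_S because the weights sum to π_D/(π_+ - π_-) and `meanS` is normalized by π_S.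
  have f4 : ∑ t, weightD p t * r₁ t = prior p true * prior p false * (v true + v false) /
      (prior p true - prior p false) +
        (1 - w₁) * (priorD p / priorS p) * ((v true - v false) / 2) := by
    rw [Fintype.sum_bool, hr₁, hr₁, weightD, weightD]
    simp only [Bool.not_true, Bool.not_false]
    have hdsum : (prior p false - prior p true ^ 2) + (prior p true - prior p false ^ 2) =
        priorD p := by
      rw [hDdef]
      linear_combination -(prior p true + prior p false) * hab
    have hkey : priorD p * meanS p v = prior p true * prior p false * (v true + v false) +
        priorD p / priorS p * ((prior p true - prior p false) * ((v true - v false) / 2)) := by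
      rw [meanS]
      field_simp
      rw [hSdef, hDdef]
      linear_combination 2 * prior p true * prior p false * (prior p true - prior p false) *
        (v true - v false) * hab
    generalize priorD p / priorS p = q at *
    field_simp
    linear_combination 2 * w₁ * e2 + 2 * (1 - w₁) * hkey + 2 * (1 - w₁) * meanS p v * hdsum
  rw [f1, f2, f3, f4]
  have hS' : θS = 1 - ηS := by linarith
  have hD' : θD = 1 - ηD := by linarith
  rw [hS', hD']
  ring

end Means

/-! ### The constants -/

section Constants

variable {p : Measure (X × Bool)} [IsProbabilityMeasure p]

/-- Since the priors sum to 1, π_+ - π_- = π_+² - π_-². -/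
theorem abs_prior_sub_le_priorS : |prior p true - prior p false| ≤ priorS p := by
  have hab := prior_add p
  unfold priorS
  rw [abs_le]
  have hb : prior p false = 1 - prior p true := by linarith
  rw [hb]
  constructor <;> nlinarith [sq_nonneg (prior p true), sq_nonneg (1 - prior p true)]

/-- Without absolute values, the two terms of `kD` with suitable signs sum to 1 - π_S = π_D. -/
theorem priorD_le_kD : priorD p ≤ kD p := by
  have hab := prior_add p
  have h1 := neg_abs_le (prior p true ^ 2 - prior p false)
  have h2 := le_abs_self (prior p true - prior p false ^ 2)
  unfold priorD kD
  have : 2 * prior p true * prior p false = (prior p false - prior p true ^ 2) +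
      (prior p true - prior p false ^ 2) := by
    linear_combination (prior p true + prior p false) * hab
  linarith

theorem sum_abs_weightS :
    ∑ t, |weightS p t| = priorS p / |prior p true - prior p false| := by
  simp [weightS, priorS, abs_div, add_div]

theorem sum_abs_weightD :
    ∑ t, |weightD p t| = kD p / |prior p true - prior p false| := by
  simp only [weightD, kD, abs_div, add_div, Fintype.sum_bool, Bool.not_true, Bool.not_false]
  rw [abs_sub_comm (prior p false)]

theorem constB_eq_zero_iff (hpos : 0 < prior p true) (hneg : 0 < prior p false)
    (hne : prior p true ≠ prior p false) {ρS ρD ρC : ℝ}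
    (hρS : 0 ≤ ρS ∧ ρS < 1) (hρD : 0 ≤ ρD ∧ ρD < 1) (hρC : 0 ≤ ρC ∧ ρC < 1) :
    (constB₁ p ρC = 0 ∧ constB₂ p ρS ρD ρC = 0) ↔ (ρS = 0 ∧ ρD = 0 ∧ ρC = 0) := by
  have hS := priorS_pos hpos
  have hK : 0 < kD p := (priorD_pos hpos hneg).trans_le priorD_le_kD
  have hc : 0 < |prior p true - prior p false| := abs_pos.2 (sub_ne_zero.2 hne)
  have h1 : 0 < 1 - ρS := by linarith [hρS.2]
  have h2 : 0 < 1 - ρD := by linarith [hρD.2]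
  have h3 : 0 < 1 - ρC := by linarith [hρC.2]
  constructor
  · rintro ⟨hB1, hB2⟩
    have hC : ρC = 0 := by
      have hx : (priorS p + kD p) / |prior p true - prior p false| ≠ 0 := by positivity
      have := (mul_eq_zero.1 hB1).resolve_left hx
      exact (div_eq_zero_iff.1 this).resolve_right h3.ne'
    have hx : 1 / |prior p true - prior p false| ≠ 0 := by positivity
    have hsum := (mul_eq_zero.1 hB2).resolve_left hx
    have hρS0 := hρS.1
    have hρD0 := hρD.1
    obtain ⟨hA, hB⟩ := (add_eq_zero_iff_of_nonneg (by positivity) (by positivity)).1 hsum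
    refine ⟨?_, ?_, hC⟩
    · have := (div_eq_zero_iff.1 hA).resolve_right (by positivity)
      exact (mul_eq_zero.1 this).resolve_left hS.ne'
    · have := (div_eq_zero_iff.1 hB).resolve_right (by positivity)
      exact (mul_eq_zero.1 this).resolve_left hK.ne'
  · rintro ⟨rfl, rfl, rfl⟩
    simp [constB₁, constB₂]

/-- The left side is the label-noise bias per unit of loss. It is enlarged to the stated constant by
π_D ≤ K, |π_+ - π_-| ≤ π_S and 1 - ρC ≤ 1, dropping one summand of each denominator. -/
theorem constB₂_ge (hpos : 0 < prior p true) (hneg : 0 < prior p false)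
    (hne : prior p true ≠ prior p false) {ρS ρD ρC : ℝ}
    (hρS : 0 ≤ ρS ∧ ρS < 1) (hρD : 0 ≤ ρD ∧ ρD < 1) (hρC : 0 ≤ ρC ∧ ρC < 1) :
    priorD p * ρD / (priorS p * (1 - ρS) + priorD p * ρD) +
      priorS p * ρS / (priorS p * ρS + priorD p * (1 - ρD)) * (priorD p / priorS p) ≤
      constB₂ p ρS ρD ρC := by
  have hS := priorS_pos hpos
  have hD := priorD_pos hpos hneg
  have hKD := priorD_le_kD (p := p)
  have hK : 0 < kD p := hD.trans_le hKD
  have hc : 0 < |prior p true - prior p false| := abs_pos.2 (sub_ne_zero.2 hne)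
  have hcS := abs_prior_sub_le_priorS (p := p)
  obtain ⟨hS0, hS1⟩ := hρS
  obtain ⟨hD0, hD1⟩ := hρD
  obtain ⟨hC0, hC1⟩ := hρC
  have h1 : 0 < 1 - ρS := by linarith
  have h2 : 0 < 1 - ρD := by linarith
  have h3 : 0 < 1 - ρC := by linarith
  have h3' : 1 - ρC ≤ 1 := by linarith
  unfold constB₂
  rw [mul_add, add_comm]
  refine add_le_add ?_ ?_
  · rw [one_div, ← div_eq_inv_mul, div_div, div_mul_div_comm,
      div_le_div_iff₀ (by positivity) (by positivity)]
    have hden : priorD p * ((1 - ρD) * (1 - ρC)) ≤ priorS p * ρS + priorD p * (1 - ρD) := by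
      have : (1 - ρD) * (1 - ρC) ≤ 1 - ρD := mul_le_of_le_one_right h2.le h3'
      have := mul_le_mul_of_nonneg_left this hD.le
      have : 0 ≤ priorS p * ρS := by positivity
      linarith
    calc priorS p * ρS * priorD p * ((1 - ρD) * (1 - ρC) * |prior p true - prior p false|)
        = priorS p * ρS * ((priorD p * ((1 - ρD) * (1 - ρC))) *
            |prior p true - prior p false|) := by ring
      _ ≤ priorS p * ρS * ((priorS p * ρS + priorD p * (1 - ρD)) * priorS p) := by gcongr
  · rw [one_div, ← div_eq_inv_mul, div_div]
    refine div_le_div₀ (by positivity) (by gcongr) (by positivity) ?_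
    calc (1 - ρS) * (1 - ρC) * |prior p true - prior p false|
        ≤ (1 - ρS) * 1 * priorS p := by gcongr
      _ ≤ priorS p * (1 - ρS) + priorD p * ρD := by
        have : 0 ≤ priorD p * ρD := by positivity
        linarith

end Constants

end

section

variable {X : Type*} [MeasurableSpace X]

/-! ### The bias of the noisy risk -/

/-- The expectation of the empirical risk under the noisy laws. -/
noncomputable def noisyRisk (p : Measure (X × Bool)) (ρS ρD ρC : ℝ) (κS κD : Measure (X × X))
    (ℓ : ℝ → Bool → ℝ) (g : X → ℝ) : ℝ :=
  ∫ z, pairFn (weightS p) (lossS p ℓ) g z ∂(noisyCompare ρC (noisySim p ρS ρD κS κD)) +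
    ∫ z, pairFn (weightD p) (lossD p ℓ) g z ∂(noisyCompare ρC (noisyDis p ρS ρD κS κD))

/-- Bounds the contribution of the swapped pairs; exchanging the positions leaves the sum of
absolute weights unchanged. -/
theorem abs_mixture_le {k m₁ m₂ : Bool → ℝ} {θ η C : ℝ} (hθ : 0 ≤ θ) (hη : 0 ≤ η)
    (h : θ + η = 1) (h₁ : ∀ t, |m₁ t| ≤ C) (h₂ : ∀ t, |m₂ t| ≤ C) :
    |θ * ∑ t, k (!t) * m₁ t + η * ∑ t, k (!t) * m₂ t| ≤ (∑ t, |k t|) * C := by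
  have hk : ∑ t, |k (!t)| = ∑ t, |k t| := by simp [add_comm]
  have a₁ := abs_sum_mul_le (k := fun t => k (!t)) h₁
  have a₂ := abs_sum_mul_le (k := fun t => k (!t)) h₂
  rw [hk] at a₁ a₂
  refine (abs_add_le _ _).trans ?_
  rw [abs_mul, abs_mul, abs_of_nonneg hθ, abs_of_nonneg hη]
  calc _ ≤ θ * ((∑ t, |k t|) * C) + η * ((∑ t, |k t|) * C) := by gcongr
    _ = _ := by rw [← add_mul, h, one_mul]

variable {p : Measure (X × Bool)} [IsProbabilityMeasure p] {ℓ : ℝ → Bool → ℝ}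
  {κS κD : Measure (X × X)} [IsProbabilityMeasure κS] [IsProbabilityMeasure κD] {ρS ρD ρC : ℝ}
  {Cg C : ℝ}

theorem abs_integral_sub_integral_le {Ω : Type*} [MeasurableSpace Ω] (μ : Measure Ω)
    [IsProbabilityMeasure μ] {f f' : Ω → ℝ} (hf : Measurable f) (hf' : Measurable f') {B : ℝ}
    (hB : ∀ x, |f x| ≤ B) (hB' : ∀ x, |f' x| ≤ B) (h : ∀ x, |f x - f' x| ≤ C) :
    |∫ x, f x ∂μ - ∫ x, f' x ∂μ| ≤ C := by
  rw [← integral_sub (integrable_of_abs_le hf hB) (integrable_of_abs_le hf' hB')]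
  exact abs_integral_le_of_abs_le h

theorem abs_lossS_le (hpos : 0 < prior p true) (hneg : 0 < prior p false)
    (hℓ : ∀ z y, 0 ≤ ℓ z y) (hCℓ : ∀ z y, |z| ≤ Cg → ℓ z y ≤ C) (z : ℝ) (hz : |z| ≤ Cg) :
    |lossS p ℓ z| ≤ C :=
  abs_convex_sub_le hpos hneg (prior_add p) (by rw [abs_of_nonneg (hℓ _ _)]; exact hCℓ _ _ hz)
    (by rw [abs_of_nonneg (hℓ _ _)]; exact hCℓ _ _ hz)

theorem abs_lossD_le (hpos : 0 < prior p true) (hneg : 0 < prior p false)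
    (hℓ : ∀ z y, 0 ≤ ℓ z y) (hCℓ : ∀ z y, |z| ≤ Cg → ℓ z y ≤ C) (z : ℝ) (hz : |z| ≤ Cg) :
    |lossD p ℓ z| ≤ C :=
  abs_convex_sub_le hpos hneg (prior_add p) (by rw [abs_of_nonneg (hℓ _ _)]; exact hCℓ _ _ hz)
    (by rw [abs_of_nonneg (hℓ _ _)]; exact hCℓ _ _ hz)

theorem abs_lossS_sub_le (hpos : 0 < prior p true) (hneg : 0 < prior p false)
    (hℓ : ∀ z y, 0 ≤ ℓ z y) (hCℓ : ∀ z y, |z| ≤ Cg → ℓ z y ≤ C) (z z' : ℝ) (hz : |z| ≤ Cg)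
    (hz' : |z'| ≤ Cg) : |lossS p ℓ z - lossS p ℓ z'| ≤ C :=
  abs_loss_sub_le hpos hneg (prior_add p) ⟨hℓ _ _, hCℓ _ _ hz⟩ ⟨hℓ _ _, hCℓ _ _ hz⟩
    ⟨hℓ _ _, hCℓ _ _ hz'⟩ ⟨hℓ _ _, hCℓ _ _ hz'⟩

theorem abs_lossD_sub_le (hpos : 0 < prior p true) (hneg : 0 < prior p false)
    (hℓ : ∀ z y, 0 ≤ ℓ z y) (hCℓ : ∀ z y, |z| ≤ Cg → ℓ z y ≤ C) (z z' : ℝ) (hz : |z| ≤ Cg)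
    (hz' : |z'| ≤ Cg) : |lossD p ℓ z - lossD p ℓ z'| ≤ C :=
  abs_loss_sub_le hpos hneg (prior_add p) ⟨hℓ _ _, hCℓ _ _ hz⟩ ⟨hℓ _ _, hCℓ _ _ hz⟩
    ⟨hℓ _ _, hCℓ _ _ hz'⟩ ⟨hℓ _ _, hCℓ _ _ hz'⟩

/-- Under p_+ the wrong-label loss has coefficient -π_+²π_- + π_+²π_- = 0, and the right-label loss
has π_+(π_+² - π_-²) = π_+(π_+ - π_-); likewise under p_-. -/
theorem risk_eq_lossS_lossD (hpos : 0 < prior p true) (hneg : 0 < prior p false)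
    (hne : prior p true ≠ prior p false) (hm : ∀ y, Measurable fun z => ℓ z y)
    (hℓ : ∀ z y, 0 ≤ ℓ z y) (hCℓ : ∀ z y, |z| ≤ Cg → ℓ z y ≤ C) {g : X → ℝ} (hg : Measurable g)
    (hgC : ∀ x, |g x| ≤ Cg) :
    risk p ℓ g = (prior p true ^ 2 * ∫ x, lossS p ℓ (g x) ∂(classCond p true) +
      prior p false ^ 2 * ∫ x, lossS p ℓ (g x) ∂(classCond p false) +
      prior p true * prior p false * (∫ x, lossD p ℓ (g x) ∂(classCond p true) +
        ∫ x, lossD p ℓ (g x) ∂(classCond p false))) / (prior p true - prior p false) := by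
  have := isProbabilityMeasure_classCond hpos
  have := isProbabilityMeasure_classCond hneg
  have hab := prior_add p
  have hc : prior p true - prior p false ≠ 0 := sub_ne_zero.2 hne
  have hB : ∀ x y, |ℓ (g x) y| ≤ C := fun x y => by
    rw [abs_of_nonneg (hℓ _ _)]
    exact hCℓ _ _ (hgC x)
  rw [risk_eq hpos hneg hm hg hB]
  have hi : ∀ (μ : Measure X) [IsProbabilityMeasure μ] (y : Bool),
      Integrable (fun x => ℓ (g x) y) μ := fun μ _ y =>
    integrable_of_abs_le ((hm y).comp hg) fun x => hB x y
  have hlS : ∀ (μ : Measure X) [IsProbabilityMeasure μ], ∫ x, lossS p ℓ (g x) ∂μ =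
      prior p true * ∫ x, ℓ (g x) true ∂μ - prior p false * ∫ x, ℓ (g x) false ∂μ := fun μ _ => by
    unfold lossS
    rw [integral_sub ((hi μ _).const_mul _) ((hi μ _).const_mul _), integral_const_mul,
      integral_const_mul]
  have hlD : ∀ (μ : Measure X) [IsProbabilityMeasure μ], ∫ x, lossD p ℓ (g x) ∂μ =
      prior p true * ∫ x, ℓ (g x) false ∂μ - prior p false * ∫ x, ℓ (g x) true ∂μ := fun μ _ => by
    unfold lossD
    rw [integral_sub ((hi μ _).const_mul _) ((hi μ _).const_mul _), integral_const_mul,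
      integral_const_mul]
  simp_rw [hlS, hlD]
  generalize ∫ x, ℓ (g x) true ∂(classCond p true) = x₁
  generalize ∫ x, ℓ (g x) false ∂(classCond p true) = x₂
  generalize ∫ x, ℓ (g x) true ∂(classCond p false) = y₁
  generalize ∫ x, ℓ (g x) false ∂(classCond p false) = y₂
  have hb : prior p false = 1 - prior p true := by linarith
  rw [hb] at hc ⊢
  field_simp
  ring

/-- Up to the factor `1 - ρC`, excess noisy risk and excess risk differ by at most the bias. -/
theorem excess_risk_sub_noisyRisk_le (hpos : 0 < prior p true) (hneg : 0 < prior p false)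
    (hne : prior p true ≠ prior p false)
    (hκS : IsCleanPairLaw p (pairS p) κS) (hκD : IsCleanPairLaw p (pairD p) κD)
    (hρS : 0 ≤ ρS ∧ ρS < 1) (hρD : 0 ≤ ρD ∧ ρD < 1) (hρC : 0 ≤ ρC ∧ ρC < 1)
    (hm : ∀ y, Measurable fun z => ℓ z y) (hC0 : 0 ≤ C)
    (hℓ : ∀ z y, 0 ≤ ℓ z y) (hCℓ : ∀ z y, |z| ≤ Cg → ℓ z y ≤ C) {g g' : X → ℝ}
    (hg : Measurable g) (hgC : ∀ x, |g x| ≤ Cg) (hg' : Measurable g') (hgC' : ∀ x, |g' x| ≤ Cg) :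
    risk p ℓ g - risk p ℓ g' - (noisyRisk p ρS ρD ρC κS κD ℓ g -
      noisyRisk p ρS ρD ρC κS κD ℓ g') / (1 - ρC) ≤
      C * (constB₁ p ρC + constB₂ p ρS ρD ρC) := by
  have := isProbabilityMeasure_classCond hpos
  have := isProbabilityMeasure_classCond hneg
  have hS := priorS_pos hpos
  have hD := priorD_pos hpos hneg
  have hc : prior p true - prior p false ≠ 0 := sub_ne_zero.2 hne
  have hB2 := constB₂_ge hpos hneg hne hρS hρD hρC
  obtain ⟨hS0, hS1⟩ := hρS
  obtain ⟨hD0, hD1⟩ := hρD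
  obtain ⟨hC0', hC1⟩ := hρC
  have h1 : 0 < 1 - ρS := by linarith
  have h2 : 0 < 1 - ρD := by linarith
  have h3 : 0 < 1 - ρC := by linarith
  set θS := priorS p * (1 - ρS) / (priorS p * (1 - ρS) + priorD p * ρD) with hθS
  set ηS := priorD p * ρD / (priorS p * (1 - ρS) + priorD p * ρD) with hηS
  set ηD := priorS p * ρS / (priorS p * ρS + priorD p * (1 - ρD)) with hηD
  set θD := priorD p * (1 - ρD) / (priorS p * ρS + priorD p * (1 - ρD)) with hθD
  have hθS0 : 0 ≤ θS := by positivity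
  have hηS0 : 0 ≤ ηS := by positivity
  have hηD0 : 0 ≤ ηD := by positivity
  have hθD0 : 0 ≤ θD := by positivity
  have hsumS : θS + ηS = 1 := by
    rw [hθS, hηS, ← add_div]
    exact div_self (by positivity)
  have hsumD : ηD + θD = 1 := by
    rw [hηD, hθD, ← add_div]
    exact div_self (by positivity)
  have hSm : Measurable (lossS p ℓ) := ((hm true).const_mul _).sub ((hm false).const_mul _)
  have hDm : Measurable (lossD p ℓ) := ((hm false).const_mul _).sub ((hm true).const_mul _)
  have hSC := abs_lossS_le hpos hneg hℓ hCℓ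
  have hDC := abs_lossD_le hpos hneg hℓ hCℓ
  obtain ⟨w₁, hw₁0, hw₁1, hw₁⟩ := hκS.exists_integral_pairS hpos hneg
  obtain ⟨w₂, hw₂0, hw₂1, hw₂⟩ := hκD.exists_integral_pairD hpos hneg
  -- The noisy risk is 1 - ρC times the unswapped sums plus ρC times the swapped ones. Dividing by 1
  -- - ρC leaves the label bias and a ρC/(1 - ρC) multiple of the swapped sums.
  have dec : ∀ g : X → ℝ, Measurable g → (∀ x, |g x| ≤ Cg) →
      risk p ℓ g - noisyRisk p ρS ρD ρC κS κD ℓ g / (1 - ρC) =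
        ηS * (1 - w₂) * ((∫ x, lossS p ℓ (g x) ∂(classCond p true) -
          ∫ x, lossS p ℓ (g x) ∂(classCond p false)) / 2) -
        ηD * (1 - w₁) * (priorD p / priorS p) * ((∫ x, lossD p ℓ (g x) ∂(classCond p true) -
          ∫ x, lossD p ℓ (g x) ∂(classCond p false)) / 2) -
        ρC / (1 - ρC) *
          ((θS * ∑ t, weightS p (!t) * ∫ z, lossS p ℓ (g (inst t z)) ∂κS +
            ηS * ∑ t, weightS p (!t) * ∫ z, lossS p ℓ (g (inst t z)) ∂κD) +
          (ηD * ∑ t, weightD p (!t) * ∫ z, lossD p ℓ (g (inst t z)) ∂κS +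
            θD * ∑ t, weightD p (!t) * ∫ z, lossD p ℓ (g (inst t z)) ∂κD)) := by
    intro g hg hgC
    have hSg : Measurable fun x => lossS p ℓ (g x) := hSm.comp hg
    have hDg : Measurable fun x => lossD p ℓ (g x) := hDm.comp hg
    have hSB : ∀ x, |lossS p ℓ (g x)| ≤ C := fun x => hSC _ (hgC x)
    have hDB : ∀ x, |lossD p ℓ (g x)| ≤ C := fun x => hDC _ (hgC x)
    have hd := risk_decomposition hpos hneg hne
      (fun y => ∫ x, lossS p ℓ (g x) ∂(classCond p y))
      (fun y => ∫ x, lossD p ℓ (g x) ∂(classCond p y))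
      (fun t => ∫ z, lossS p ℓ (g (inst t z)) ∂κS) (fun t => ∫ z, lossS p ℓ (g (inst t z)) ∂κD)
      (fun t => ∫ z, lossD p ℓ (g (inst t z)) ∂κS) (fun t => ∫ z, lossD p ℓ (g (inst t z)) ∂κD)
      hsumS hsumD (fun t => hw₁ t _ hSg C hSB) (fun t => hw₂ t _ hSg C hSB)
      (fun t => hw₁ t _ hDg C hDB) (fun t => hw₂ t _ hDg C hDB)
    rw [risk_eq_lossS_lossD hpos hneg hne hm hℓ hCℓ hg hgC, hd, noisyRisk, noisySim, noisyDis,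
      integral_pairFn_noisyCompare hC0' hC1 hθS0 hηS0 hsumS κS κD _ hSm hg hSB,
      integral_pairFn_noisyCompare hC0' hC1 hηD0 hθD0 hsumD κS κD _ hDm hg hDB]
    field_simp
    ring
  -- From here the identity is used only on differences between g and g', where every mean
  -- contributes at most C.
  have hSd : ∀ x, |lossS p ℓ (g x) - lossS p ℓ (g' x)| ≤ C := fun x =>
    abs_lossS_sub_le hpos hneg hℓ hCℓ _ _ (hgC x) (hgC' x)
  have hDd : ∀ x, |lossD p ℓ (g x) - lossD p ℓ (g' x)| ≤ C := fun x =>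
    abs_lossD_sub_le hpos hneg hℓ hCℓ _ _ (hgC x) (hgC' x)
  have iS : ∀ (μ : Measure X) [IsProbabilityMeasure μ],
      |∫ x, lossS p ℓ (g x) ∂μ - ∫ x, lossS p ℓ (g' x) ∂μ| ≤ C := fun μ _ =>
    abs_integral_sub_integral_le μ (hSm.comp hg) (hSm.comp hg') (fun x => hSC _ (hgC x))
      (fun x => hSC _ (hgC' x)) hSd
  have iD : ∀ (μ : Measure X) [IsProbabilityMeasure μ],
      |∫ x, lossD p ℓ (g x) ∂μ - ∫ x, lossD p ℓ (g' x) ∂μ| ≤ C := fun μ _ =>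
    abs_integral_sub_integral_le μ (hDm.comp hg) (hDm.comp hg') (fun x => hDC _ (hgC x))
      (fun x => hDC _ (hgC' x)) hDd
  have jS : ∀ (κ : Measure (X × X)) [IsProbabilityMeasure κ] (t : Bool),
      |∫ z, lossS p ℓ (g (inst t z)) ∂κ - ∫ z, lossS p ℓ (g' (inst t z)) ∂κ| ≤ C := fun κ _ t =>
    abs_integral_sub_integral_le κ (hSm.comp (hg.comp (measurable_inst t)))
      (hSm.comp (hg'.comp (measurable_inst t))) (fun x => hSC _ (hgC _))
      (fun x => hSC _ (hgC' _)) fun z => hSd _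
  have jD : ∀ (κ : Measure (X × X)) [IsProbabilityMeasure κ] (t : Bool),
      |∫ z, lossD p ℓ (g (inst t z)) ∂κ - ∫ z, lossD p ℓ (g' (inst t z)) ∂κ| ≤ C := fun κ _ t =>
    abs_integral_sub_integral_le κ (hDm.comp (hg.comp (measurable_inst t)))
      (hDm.comp (hg'.comp (measurable_inst t))) (fun x => hDC _ (hgC _))
      (fun x => hDC _ (hgC' _)) fun z => hDd _
  have bS := abs_mixture_le (k := weightS p) hθS0 hηS0 hsumS (jS κS) (jS κD)
  have bD := abs_mixture_le (k := weightD p) hηD0 hθD0 hsumD (jD κS) (jD κD)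
  rw [sum_abs_weightS] at bS
  rw [sum_abs_weightD] at bD
  simp only [mul_sub, Finset.sum_sub_distrib] at bS bD
  have hr : 0 ≤ ρC / (1 - ρC) := by positivity
  have t3 := mul_le_mul_of_nonneg_left
    (add_le_add (abs_le.1 bS).1 (abs_le.1 bD).1) hr
  have hu := abs_le.1 (iS (classCond p true))
  have hu' := abs_le.1 (iS (classCond p false))
  have hv := abs_le.1 (iD (classCond p true))
  have hv' := abs_le.1 (iD (classCond p false))
  -- Half the difference of two numbers in [-C, C]; the factor 1 - w₂ is bounded by 1, so the result
  -- holds for all mixing weights.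
  have t1 : ηS * (1 - w₂) * (((∫ x, lossS p ℓ (g x) ∂(classCond p true) -
      ∫ x, lossS p ℓ (g' x) ∂(classCond p true)) - (∫ x, lossS p ℓ (g x) ∂(classCond p false) -
      ∫ x, lossS p ℓ (g' x) ∂(classCond p false))) / 2) ≤ ηS * 1 * C := by
    refine (mul_le_mul_of_nonneg_left (?_ : _ ≤ C)
      (mul_nonneg hηS0 (sub_nonneg.2 hw₂1))).trans ?_
    · linarith
    · gcongr
      linarith
  have t2 : ηD * (1 - w₁) * (priorD p / priorS p) * (((∫ x, lossD p ℓ (g' x) ∂(classCond p true) -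
      ∫ x, lossD p ℓ (g x) ∂(classCond p true)) - (∫ x, lossD p ℓ (g' x) ∂(classCond p false) -
      ∫ x, lossD p ℓ (g x) ∂(classCond p false))) / 2) ≤
      ηD * 1 * (priorD p / priorS p) * C := by
    refine (mul_le_mul_of_nonneg_left (?_ : _ ≤ C) (mul_nonneg
      (mul_nonneg hηD0 (sub_nonneg.2 hw₁1)) (by positivity))).trans ?_
    · linarith
    · gcongr
      linarith
  have t4 := mul_le_mul_of_nonneg_left hB2 hC0
  have hB1 : constB₁ p ρC = (priorS p / |prior p true - prior p false| +
      kD p / |prior p true - prior p false|) * (ρC / (1 - ρC)) := by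
    rw [constB₁, add_div]
  have hd := dec g hg hgC
  have hd' := dec g' hg' hgC'
  rw [hB1, sub_div]
  have hsplit : risk p ℓ g - risk p ℓ g' - (noisyRisk p ρS ρD ρC κS κD ℓ g / (1 - ρC) -
      noisyRisk p ρS ρD ρC κS κD ℓ g' / (1 - ρC)) =
      (risk p ℓ g - noisyRisk p ρS ρD ρC κS κD ℓ g / (1 - ρC)) -
      (risk p ℓ g' - noisyRisk p ρS ρD ρC κS κD ℓ g' / (1 - ρC)) := by ring
  rw [hsplit, hd, hd']
  linarith

end

section

variable {X : Type*} [MeasurableSpace X]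

/-! ### The estimation error -/

/-- The supremum dominates the value at one fixed g, whose average over signs vanishes by σ ↦ -σ. It
serves to show that the complexity constant is nonnegative. -/
theorem rademacher_nonneg {G : Set (X → ℝ)} (hne : G.Nonempty) {Cg : ℝ}
    (hCg : ∀ g ∈ G, ∀ x, |g x| ≤ Cg) (n : ℕ) (μ : Measure X) : 0 ≤ rademacher G n μ := by
  obtain ⟨g, hg⟩ := hne
  refine integral_nonneg fun x => mul_nonneg (by positivity) ?_
  set F : (Fin n → ℤˣ) → ℝ := fun σ =>
    1 / n * ∑ i, ((σ i : ℤ) : ℝ) * g (x i) with hF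
  have hle : ∑ σ, F σ ≤ ∑ σ : Fin n → ℤˣ,
      ⨆ g : G, (1 / (n : ℝ)) * ∑ i, ((σ i : ℤ) : ℝ) * (g : X → ℝ) (x i) := by
    refine Finset.sum_le_sum fun σ _ => ?_
    refine le_ciSup (f := fun g : G => (1 / (n : ℝ)) * ∑ i, ((σ i : ℤ) : ℝ) * (g : X → ℝ) (x i))
      (bddAbove_of_abs_le (B := |1 / (n : ℝ)| * (Fintype.card (Fin n) * Cg)) fun g => ?_) ⟨g, hg⟩
    rw [abs_mul]
    refine mul_le_mul_of_nonneg_left (abs_sum_le_card_mul fun i => ?_) (abs_nonneg _)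
    rw [abs_unit_mul]
    exact hCg g g.2 _
  have hneg : ∑ σ, F σ = -∑ σ, F σ := by
    conv_lhs => rw [← Equiv.sum_comp (Equiv.neg (Fin n → ℤˣ)) F]
    rw [← Finset.sum_neg_distrib]
    exact Finset.sum_congr rfl fun σ _ => by simp [hF]
  linarith

/-- Converts the rate 1/√n to 1/√(2n); the factor √2 this costs is absorbed by `W`. -/
theorem estimation_term_le {a c V W A r : ℝ} (ha : 0 ≤ a) (hc : 0 < c) (hr : 0 < r)
    (hV : 0 ≤ V) (hVW : √2 * V ≤ W) (hA : a / r ≤ A) {n : ℕ} (hn : 0 < n) :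
    a / c * V / √(n : ℝ) / r ≤ W / c * (A / √(2 * (n : ℝ))) := by
  have hn' : 0 < √(n : ℝ) := Real.sqrt_pos.2 (by exact_mod_cast hn)
  have h2 : 0 < √(2 : ℝ) := Real.sqrt_pos.2 (by norm_num)
  have e : a / c * V / √(n : ℝ) / r = (√2 * V) / c * ((a / r) / √(2 * (n : ℝ))) := by
    rw [Real.sqrt_mul (by norm_num)]
    field_simp
  rw [e]
  have : 0 ≤ a / r := by positivity
  have : 0 ≤ √2 * V := by positivity
  gcongr
  exact div_nonneg (this.trans hVW) hc.le

/-- The square-root term matches exactly up to enlarging log(2/δ) to log(4/δ); the complexity term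
uses √2 ≤ 2. -/
theorem sqrt_two_mul_deviation_le {L CG C δ : ℝ} (hL : 0 ≤ L) (hCG : 0 ≤ CG) (hC : 0 ≤ C)
    (hδ : 0 < δ) :
    √2 * (2 * L * CG + C * √(2 * Real.log (1 / (δ / 2)))) ≤
      4 * L * CG + 2 * C * √(Real.log (4 / δ)) := by
  have h2 : √(2 : ℝ) ≤ 2 := by
    rw [Real.sqrt_le_left (by norm_num)]
    norm_num
  have hlog : √(Real.log (1 / (δ / 2))) ≤ √(Real.log (4 / δ)) := by
    refine Real.sqrt_le_sqrt (Real.log_le_log (by positivity) ?_)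
    rw [one_div_div]
    gcongr
    norm_num
  have hsq : √(2 : ℝ) * √2 = 2 := Real.mul_self_sqrt (by norm_num)
  have hLC : 0 ≤ L * CG := mul_nonneg hL hCG
  have t1 := mul_le_mul_of_nonneg_right h2 hLC
  have t2 := mul_le_mul_of_nonneg_left hlog hC
  rw [Real.sqrt_mul (by norm_num)]
  calc √2 * (2 * L * CG + C * (√2 * √(Real.log (1 / (δ / 2)))))
      = 2 * (√2 * (L * CG)) + (√2 * √2) * (C * √(Real.log (1 / (δ / 2)))) := by ring
    _ ≤ _ := by
      rw [hsq]
      linarith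

theorem le_constA₁ {p : Measure (X × Bool)} (hpos : 0 < prior p true) (hneg : 0 < prior p false)
    {ρS ρD ρC : ℝ} (hρS : ρS < 1) (hρD : 0 ≤ ρD) (hρC : ρC < 1) :
    priorS p / (1 - ρC) ≤ constA₁ p ρS ρD ρC := by
  have hS := priorS_pos hpos
  have hD := priorD_pos hpos hneg
  have h1 : 0 < 1 - ρS := by linarith
  have h3 : 0 < 1 - ρC := by linarith
  have h4 : 0 ≤ priorD p * ρD := by positivity
  rw [constA₁, ← div_div]
  refine div_le_div_of_nonneg_right ?_ h3.le
  rw [le_div_iff₀ h1]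
  linarith

theorem le_constA₂ {p : Measure (X × Bool)} (hpos : 0 < prior p true) (hneg : 0 < prior p false)
    {ρS ρD ρC : ℝ} (hρS : 0 ≤ ρS) (hρD : ρD < 1) (hρC : ρC < 1) :
    kD p / (1 - ρC) ≤ constA₂ p ρS ρD ρC := by
  have hS := priorS_pos hpos
  have hD := priorD_pos hpos hneg
  have hK : 0 ≤ kD p := add_nonneg (abs_nonneg _) (abs_nonneg _)
  have h1 : 0 < 1 - ρD := by linarith
  have h3 : 0 < 1 - ρC := by linarith
  have h4 : 0 ≤ priorS p * ρS := by positivity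
  rw [constA₂, ← div_div]
  refine div_le_div_of_nonneg_right ?_ h3.le
  rw [le_div_iff₀ (by positivity)]
  exact mul_le_mul_of_nonneg_left (by linarith) hK

theorem isProbabilityMeasure_noisySim {p : Measure (X × Bool)} (hpos : 0 < prior p true)
    (hneg : 0 < prior p false) {ρS ρD : ℝ} (hρS : ρS < 1) (hρD : 0 ≤ ρD)
    (κS κD : Measure (X × X)) [IsProbabilityMeasure κS] [IsProbabilityMeasure κD] :
    IsProbabilityMeasure (noisySim p ρS ρD κS κD) := by
  have hS := priorS_pos hpos
  have hD := priorD_pos hpos hneg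
  have h1 : 0 < 1 - ρS := by linarith
  refine isProbabilityMeasure_ofReal_smul_add _ _ (by positivity) (by positivity) ?_
  rw [← add_div]
  exact div_self (by positivity)

theorem isProbabilityMeasure_noisyDis {p : Measure (X × Bool)} (hpos : 0 < prior p true)
    (hneg : 0 < prior p false) {ρS ρD : ℝ} (hρS : 0 ≤ ρS) (hρD : ρD < 1)
    (κS κD : Measure (X × X)) [IsProbabilityMeasure κS] [IsProbabilityMeasure κD] :
    IsProbabilityMeasure (noisyDis p ρS ρD κS κD) := by
  have hS := priorS_pos hpos
  have hD := priorD_pos hpos hneg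
  have h1 : 0 < 1 - ρD := by linarith
  refine isProbabilityMeasure_ofReal_smul_add _ _ (by positivity) (by positivity) ?_
  rw [← add_div]
  exact div_self (by positivity)

/-- The two samples are independent, and (1 - δ/2)² = 1 - δ + δ²/4. -/
theorem one_sub_ofReal_le_prod {α β : Type*} [MeasurableSpace α] [MeasurableSpace β]
    (μ : Measure α) (ν : Measure β) [SFinite ν] {s : Set α} {t : Set β} {δ : ℝ} (hδ : 0 ≤ δ)
    (hδ1 : δ ≤ 1) (hs : ENNReal.ofReal (1 - δ / 2) ≤ μ s) (ht : ENNReal.ofReal (1 - δ / 2) ≤ ν t) :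
    1 - ENNReal.ofReal δ ≤ μ.prod ν (s ×ˢ t) := by
  rw [Measure.prod_prod, ← ENNReal.ofReal_one, ← ENNReal.ofReal_sub _ hδ]
  refine le_trans ?_ (mul_le_mul' hs ht)
  rw [← ENNReal.ofReal_mul (by linarith)]
  refine ENNReal.ofReal_le_ofReal ?_
  nlinarith [sq_nonneg δ]

end

end SDPcomp

theorem theorem4 {X : Type*} [MeasurableSpace X]
    -- the data distribution; both classes occur and the priors differ
    (p : Measure (X × Bool)) [IsProbabilityMeasure p]
    (hpos : 0 < SDPcomp.prior p true) (hneg : 0 < SDPcomp.prior p false)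
    (hne : SDPcomp.prior p true ≠ SDPcomp.prior p false)
    -- the laws of correctly labelled similar and dissimilar pairs
    (κS κD : Measure (X × X)) [IsProbabilityMeasure κS] [IsProbabilityMeasure κD]
    (hκS : SDPcomp.IsCleanPairLaw p (SDPcomp.pairS p) κS)
    (hκD : SDPcomp.IsCleanPairLaw p (SDPcomp.pairD p) κD)
    -- the noise rates
    (ρS ρD ρC : ℝ) (hρS : 0 ≤ ρS ∧ ρS < 1) (hρD : 0 ≤ ρD ∧ ρD < 1) (hρC : 0 ≤ ρC ∧ ρC < 1)
    -- the function class
    (G : Set (X → ℝ)) (hGm : ∀ g ∈ G, Measurable g) (hGs : SDPcomp.PointwiseSeparable G)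
    (Cg : ℝ) (hCg : ∀ g ∈ G, ∀ x, |g x| ≤ Cg)
    (CG : ℝ) (hCG : ∀ n : ℕ, 0 < n → ∀ μ : Measure X, IsProbabilityMeasure μ →
      SDPcomp.rademacher G n μ ≤ CG / √(n : ℝ))
    -- the loss
    (ℓ : ℝ → Bool → ℝ) (hℓ : ∀ z y, 0 ≤ ℓ z y)
    (Cℓ : ℝ) (hCℓ : ∀ z y, |z| ≤ Cg → ℓ z y ≤ Cℓ)
    (L : ℝ) (hL : ∀ z z' y, |ℓ z y - ℓ z' y| ≤ L * |z - z'|)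
    -- a minimizer of the classification risk
    (gstar : X → ℝ) (hgstar : gstar ∈ G) (hmin : IsMinOn (SDPcomp.risk p ℓ) G gstar)
    -- the sample sizes
    (nS nD : ℕ) (hnS : 0 < nS) (hnD : 0 < nD) :
    (∀ δ : ℝ, 0 < δ →
      ∃ E : Set (SDPcomp.Sample X nS nD), MeasurableSet E ∧
        1 - ENNReal.ofReal δ ≤ SDPcomp.noisySampleLaw p ρS ρD ρC κS κD nS nD E ∧
        ∀ d ∈ E, ∀ gbar ∈ G, IsMinOn (SDPcomp.empRisk p ℓ d) G gbar →
          SDPcomp.risk p ℓ gbar - SDPcomp.risk p ℓ gstar ≤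
            SDPcomp.constC p L CG Cℓ δ *
              (SDPcomp.constA₁ p ρS ρD ρC / √(2 * (nS : ℝ)) +
                SDPcomp.constA₂ p ρS ρD ρC / √(2 * (nD : ℝ))) +
            Cℓ * (SDPcomp.constB₁ p ρC + SDPcomp.constB₂ p ρS ρD ρC)) ∧
    ((SDPcomp.constB₁ p ρC = 0 ∧ SDPcomp.constB₂ p ρS ρD ρC = 0) ↔
      (ρS = 0 ∧ ρD = 0 ∧ ρC = 0)) := by
  have hab := SDPcomp.prior_add p
  refine ⟨fun δ hδ => ?_, SDPcomp.constB_eq_zero_iff hpos hneg hne hρS hρD hρC⟩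
  -- For δ ≥ 1 the truncated `1 - ENNReal.ofReal δ` is 0, and the empty event suffices.
  rcases le_or_gt 1 δ with hδ1 | hδ1
  · refine ⟨∅, MeasurableSet.empty, ?_, by simp⟩
    rw [tsub_eq_zero_of_le (by simpa using ENNReal.ofReal_le_ofReal hδ1)]
    exact zero_le
  have hP := SDPcomp.isProbabilityMeasure_classCond hpos
  -- A probability measure forces `X` to be nonempty, so `gstar` takes a value at which the loss
  -- bound shows 0 ≤ `Cℓ`.
  obtain ⟨x₀⟩ := nonempty_of_isProbabilityMeasure (SDPcomp.classCond p true)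
  have hCℓ0 : 0 ≤ Cℓ := (hℓ _ true).trans (hCℓ _ true (hCg gstar hgstar x₀))
  have hL0 : 0 ≤ L := by
    have := (abs_nonneg _).trans (hL 1 0 true)
    simpa using this
  have hCG0 : 0 ≤ CG := by
    have := (SDPcomp.rademacher_nonneg ⟨gstar, hgstar⟩ hCg 1 _).trans (hCG 1 one_pos _ hP)
    simpa using this
  have hm : ∀ y, Measurable fun z => ℓ z y := fun y => by
    have : LipschitzWith L.toNNReal fun z => ℓ z y := LipschitzWith.of_dist_le_mul fun z z' => by
      simpa [Real.dist_eq, Real.coe_toNNReal L hL0] using hL z z' y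
    exact this.continuous.measurable
  have hQS := SDPcomp.isProbabilityMeasure_noisySim hpos hneg hρS.2 hρD.1 κS κD
  have hQD := SDPcomp.isProbabilityMeasure_noisyDis hpos hneg hρS.1 hρD.2 κS κD
  have hQS' := SDPcomp.isProbabilityMeasure_noisyCompare hρC.1 hρC.2
    (SDPcomp.noisySim p ρS ρD κS κD)
  have hQD' := SDPcomp.isProbabilityMeasure_noisyCompare hρC.1 hρC.2
    (SDPcomp.noisyDis p ρS ρD κS κD)
  obtain ⟨ES, hES, hPS, hS⟩ := SDPcomp.exists_uniform_deviation hGm hGs hCg hgstar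
    (SDPcomp.weightS p) (h := SDPcomp.lossS p ℓ) hL0
    (fun z z' => SDPcomp.abs_convex_lipschitz_le hpos hneg hab (hL z z' true) (hL z z' false)) hCℓ0
    (SDPcomp.abs_lossS_le hpos hneg hℓ hCℓ) (SDPcomp.abs_lossS_sub_le hpos hneg hℓ hCℓ) hnS
    (SDPcomp.noisyCompare ρC (SDPcomp.noisySim p ρS ρD κS κD)) (hCG nS hnS) (half_pos hδ)
    (by linarith)
  obtain ⟨ED, hED, hPD, hD⟩ := SDPcomp.exists_uniform_deviation hGm hGs hCg hgstar
    (SDPcomp.weightD p) (h := SDPcomp.lossD p ℓ) hL0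
    (fun z z' => SDPcomp.abs_convex_lipschitz_le hpos hneg hab (hL z z' false) (hL z z' true)) hCℓ0
    (SDPcomp.abs_lossD_le hpos hneg hℓ hCℓ) (SDPcomp.abs_lossD_sub_le hpos hneg hℓ hCℓ) hnD
    (SDPcomp.noisyCompare ρC (SDPcomp.noisyDis p ρS ρD κS κD)) (hCG nD hnD) (half_pos hδ)
    (by linarith)
  refine ⟨ES ×ˢ ED, hES.prod hED,
    SDPcomp.one_sub_ofReal_le_prod _ _ hδ.le hδ1.le hPS hPD, fun d hd gbar hgbar hERM => ?_⟩
  have hS' := hS d.1 hd.1 gbar hgbar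
  have hD' := hD d.2 hd.2 gbar hgbar
  have hle : SDPcomp.empRisk p ℓ d gbar ≤ SDPcomp.empRisk p ℓ d gstar := hERM hgstar
  rw [SDPcomp.empRisk_eq, SDPcomp.empRisk_eq] at hle
  rw [SDPcomp.sum_abs_weightS] at hS'
  rw [SDPcomp.sum_abs_weightD] at hD'
  have hbias := SDPcomp.excess_risk_sub_noisyRisk_le hpos hneg hne hκS hκD hρS hρD hρC hm hCℓ0 hℓ
    hCℓ (hGm gbar hgbar) (hCg gbar hgbar) (hGm gstar hgstar) (hCg gstar hgstar)
  have hr : 0 < 1 - ρC := by linarith [hρC.2]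
  have hc : 0 < |SDPcomp.prior p true - SDPcomp.prior p false| := abs_pos.2 (sub_ne_zero.2 hne)
  have hVW := SDPcomp.sqrt_two_mul_deviation_le hL0 hCG0 hCℓ0 hδ
  have hV : 0 ≤ 2 * L * CG + Cℓ * √(2 * Real.log (1 / (δ / 2))) := by positivity
  have hK : 0 ≤ SDPcomp.kD p := add_nonneg (abs_nonneg _) (abs_nonneg _)
  have e1 := SDPcomp.estimation_term_le (SDPcomp.priorS_pos hpos).le hc hr hV hVW
    (SDPcomp.le_constA₁ hpos hneg hρS.2 hρD.1 hρC.2) hnS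
  have e2 := SDPcomp.estimation_term_le hK hc hr hV hVW
    (SDPcomp.le_constA₂ hpos hneg hρS.1 hρD.2 hρC.2) hnD
  have hsum := add_le_add hS' hD'
  -- Empirical minimality of `gbar` bounds the excess noisy risk by the two deviations relative to
  -- `gstar`.
  have hnoisy : SDPcomp.noisyRisk p ρS ρD ρC κS κD ℓ gbar -
      SDPcomp.noisyRisk p ρS ρD ρC κS κD ℓ gstar ≤ _ := le_trans (by
    unfold SDPcomp.noisyRisk
    linarith [hle]) hsum
  have hnoisy := div_le_div_of_nonneg_right hnoisy hr.le
  rw [add_div] at hnoisy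
  rw [SDPcomp.constC, mul_add]
  linarith
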